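/- Let $\mathcal X$ be a measurable space, let $\mathcal Y$ (labels) and $\widetilde{\mathcal X}$ (codes) be finite sets with $|Y|$ and $|\widetilde X|$ elements, and let $\{p_\theta(\tilde x\mid x)\}_{\theta\in\Theta}$ be a family of probabilistic encoders (Markov kernels) from $\mathcal X$ to $\widetilde{\mathcal X}$; deterministic encoders are a special case. Let $d_\Theta$ be the VC dimension of the encoder, that is, the VC dimension of the family of subgraphs $\{(x,\tilde x,t)\in\mathcal X\times\widetilde{\mathcal X}\times\mathbb R : t<p_\theta(\tilde x\mid x)\}$, $\theta\in\Theta$ (for deterministic encoders: of the graphs $\{(x,\tilde x):\widetilde X_\theta(x)=\tilde x\}$; for deterministic encoders with two codes this is the usual VC dimension). Assume $1\le d_\Theta<\infty$, and assume that the class is pointwise separable: there is a countable $S\subseteq\Theta$ such that for every $\theta\in\Theta$ some sequence $\theta_k\in S$ satisfies $p_{\theta_k}(\tilde x\mid x)\to p_\theta(\tilde x\mid x)$ for all $x,\tilde x$ (for instance, $\Theta\subseteq\mathbb R^p$ and $p_\theta(\tilde x\mid x)$ is continuous in $\theta$). A task is a probability distribution on $\mathcal X\times\mathcal Y$. Tasks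 $T^1,\dots,T^n$ are drawn i.i.d. from a probability distribution $\tau$ on tasks, and, given the tasks, each $T^i$ carries a data set of $m\ge1$ i.i.d. samples $(x^i_j,y^i_j)\sim T^i$, independently across tasks. For a task $T$ let $I_T(\widetilde X_\theta;Y)=H(\widetilde X_\theta)-H(\widetilde X_\theta\mid Y)$ be the mutual information (natural logarithms) of the joint distribution $q(\tilde x,y)=\mathbb E_{(x,y')\sim T}[p_\theta(\tilde x\mid x)\mathbf 1\{y'=y\}]$, and let $\hat I_i(\widetilde X_\theta;Y)$ be its plug-in estimate, the mutual information of $\hat q_i(\tilde x,y)=\frac1m\sum_{j=1}^m p_\theta(\tilde x\mid x^i_j)\mathbf 1\{y^i_j=y\}$. Put $$\mathcal L(\tau,\theta)=-\mathbb E_{T\sim\tau}\,I_T(\widetilde X_\theta;Y),\qquad \hat{\mathcal L}(T^{1:n},\theta)=-\frac1n\sum_{i=1}^n\hat I_i(\widetilde X_\theta;Y).$$ For every $\delta\in(0,1)$ there is a constant $K>0$, depending only on $\delta$, such that in every such setting with $n\ge 2d_\Theta$, with probability at least $1-\delta$, simultaneously for all $\theta\in\Theta$, $$\mathcal L(\tau,\theta)-\hat{\mathcal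 L}(T^{1:n},\theta)\le K(\log|\widetilde X|)^{3/2}\sqrt{\frac{d_\Theta}{n}\log\frac n{d_\Theta}}+K\,\frac{|\widetilde X|\log m}{\sqrt m}+K\,\frac{|\widetilde X|\,|Y|}{m}.$$ -/

import Mathlib

open MeasureTheory ProbabilityTheory Filter Topology

noncomputable section

namespace DiscreteCodes

/-! ### Information quantities of a finite joint distribution (natural logarithms) -/

/-- Shannon entropy `-∑ a, p a * log (p a)` of a probability vector. -/
def entropy {A : Type*} [Fintype A] (p : A → ℝ) : ℝ :=
  ∑ a, Real.negMulLog (p a)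

/-- Mutual information `I(A; B) = H(A) - H(A | B)` of a pair with joint probability mass function
`q`, where `H(A | B) = ∑ b, P(B = b) * H(A | B = b)`. -/
def mutualInfo {A B : Type*} [Fintype A] [Fintype B] (q : A → B → ℝ) : ℝ :=
  entropy (fun a => ∑ b, q a b) -
    ∑ b, (∑ a, q a b) * entropy (fun a => q a b / ∑ a', q a' b)

/-! ### VC dimension -/

/-- The family `𝒜` shatters the finite set `S`: every subset of `S` is cut out by a member. -/
def Shatters {α : Type*} (𝒜 : Set (Set α)) (S : Finset α) : Prop :=
  ∀ t ⊆ S, ∃ A ∈ 𝒜, ∀ a ∈ S, a ∈ A ↔ a ∈ t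

/-- The Vapnik-Chervonenkis dimension of a family of sets, `⊤` if it is infinite. -/
def vcDim {α : Type*} (𝒜 : Set (Set α)) : ℕ∞ :=
  ⨆ S ∈ {S : Finset α | Shatters 𝒜 S}, (S.card : ℕ∞)

section Encoder

variable {Θ X C Y : Type*} [MeasurableSpace X] [MeasurableSpace C]

/-- The VC dimension of a parametrized encoder `p θ (c | x)`: the VC dimension of the subgraphs
`{(x, c, t) | t < p θ (c | x)}` of the functions `(x, c) ↦ p θ (c | x)`. For deterministic encoders
this is the VC dimension of the graphs `{(x, c) | f θ x = c}`; for deterministic encoders with two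
codes it is the usual VC dimension of a class of binary classifiers. -/
def encoderVCDim (p : Θ → Kernel X C) : ℕ∞ :=
  vcDim (Set.range fun θ : Θ => {a : (X × C) × ℝ | a.2 < (p θ a.1.1).real {a.1.2}})

/-- The encoder class is pointwise separable: countably many parameters suffice to approximate
every `p θ (c | x)`, simultaneously at all `(x, c)`, by pointwise limits of sequences. -/
def PointwiseSeparable (p : Θ → Kernel X C) : Prop :=
  ∃ S : Set Θ, S.Countable ∧ ∀ θ : Θ, ∃ u : ℕ → Θ, (∀ k, u k ∈ S) ∧
    ∀ (x : X) (c : C),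
      Tendsto (fun k => (p (u k) x).real {c}) atTop (𝓝 ((p θ x).real {c}))

variable [MeasurableSpace Y]

/-- The joint probability mass function of `(code, label)` when `(x, y)` has law `T` and the code
is drawn from `κ (· | x)`: `q c y = 𝔼[κ (c | x) 1{label = y}]`. -/
def jointPMF (κ : Kernel X C) (T : Measure (X × Y)) (c : C) (y : Y) : ℝ :=
  ∫ z in {z : X × Y | z.2 = y}, (κ z.1).real {c} ∂T

open Classical in
/-- The same for the empirical distribution of a data set `D` of size `m`. -/
def empiricalPMF {m : ℕ} (κ : Kernel X C) (D : Fin m → X × Y) (c : C) (y : Y) : ℝ :=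
  (1 / (m : ℝ)) * ∑ j, if (D j).2 = y then (κ (D j).1).real {c} else 0

/-- The expected loss: minus the mutual information between codes and labels, averaged over tasks
drawn from the task distribution `τ`. -/
def expectedLoss [Fintype C] [Fintype Y] (τ : Measure (ProbabilityMeasure (X × Y)))
    (κ : Kernel X C) : ℝ :=
  -∫ T, mutualInfo (jointPMF κ (T : Measure (X × Y))) ∂τ

/-- The empirical loss: minus the plug-in mutual information, averaged over the data sets. -/
def empiricalLoss [Fintype C] [Fintype Y] {n m : ℕ} (D : Fin n → Fin m → X × Y)
    (κ : Kernel X C) : ℝ :=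
  -((1 / (n : ℝ)) * ∑ i, mutualInfo (empiricalPMF κ (D i)))

end Encoder

/-! ### The sampling model -/

/-- Given a task `T`, draw a data set of `m` i.i.d. samples from `T`. -/
def sampleKernel (Z : Type*) [MeasurableSpace Z] (m : ℕ) :
    Kernel (ProbabilityMeasure Z) (Fin m → Z) where
  toFun T := Measure.pi fun _ : Fin m => (T : Measure Z)
  measurable' := by
    refine Measurable.measure_of_isPiSystem_of_isProbabilityMeasure
      generateFrom_pi.symm isPiSystem_pi ?_
    rintro _ ⟨s, hs, rfl⟩
    simp only [Measure.pi_pi]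
    refine Finset.measurable_prod _ fun i _ => ?_
    exact (Measure.measurable_coe (hs i (Set.mem_univ i))).comp measurable_subtype_coe

/-- The law of the `n` data sets: the tasks are drawn i.i.d. from `τ`, and each of them carries `m`
i.i.d. samples. -/
def dataLaw {Z : Type*} [MeasurableSpace Z] (τ : Measure (ProbabilityMeasure Z)) (n m : ℕ) :
    Measure (Fin n → Fin m → Z) :=
  Measure.pi fun _ : Fin n => sampleKernel Z m ∘ₘ τ

end DiscreteCodes

end

/-!
The loss difference splits into a bias and a uniform deviation.

*Bias.* Write `I(C; Y) = H(C) + H(Y) - H(C, Y)`. By concavity the plug-in estimates of `H(C)` and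
`H(Y)` are too small on average, which helps. Each of the `|C| |Y|` terms of `H(C, Y)` is
underestimated by at most `1 / m` on average, by comparison with the `χ²` divergence. So on average
a plug-in mutual information exceeds the true one by at most `|C| |Y| / m`
(`integral_mutualInfo_empiricalMean_le`), and the term with `log m / √m` is not needed.

*Deviation.* The plug-in informations of the `n` data sets are i.i.d. and bounded by `log |C|`.
Symmetrization with an independent second sample, for exponential moments, reduces their uniform
deviation to a maximum over a finite net (`measure_exists_deviation_le`). The net has to be
independent of `m`. A union bound over sign patterns on all `n m` inputs would cost `log m`;
instead the encoders are covered in the empirical `L¹` distance. A family of `N` functions that are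
`ρ`-separated in this distance is separated by `O(log N / ρ)` points with thresholds, so
Sauer-Shelah gives `log N = O(d log (1 / ρ))` whatever the number of inputs (`exists_net`).
Mutual information is Lipschitz up to a logarithm in the `L¹` distance of joint distributions with
the same label marginal (`abs_mutualInfo_sub_le`), and `ρ = d / (n |C|)` makes the approximation
error negligible.

Both losses are continuous under pointwise convergence of the encoders, so pointwise separability
reduces the class to a countable one, and continuity of measure to a finite one
(`measure_exists_le_of_finset`).
-/

noncomputable section

namespace DiscreteCodes

/-! ### Covering numbers of VC classes -/

lemma card_le_of_shatters {α : Type*} {𝒜 : Set (Set α)} {d : ℕ} (h : vcDim 𝒜 ≤ d)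
    {S : Finset α} (hS : Shatters 𝒜 S) : S.card ≤ d := by
  have : (S.card : ℕ∞) ≤ vcDim 𝒜 :=
    le_iSup₂ (f := fun (S : Finset α) (_ : S ∈ {S : Finset α | Shatters 𝒜 S}) => (S.card : ℕ∞)) S hS
  exact_mod_cast this.trans h

/-- Sauer-Shelah for a possibly infinite family of subsets of a possibly infinite type: the number
of traces on a finite set. -/
lemma card_traces_le {α : Type*} [DecidableEq α] {𝒜 : Set (Set α)} {d : ℕ} (h : vcDim 𝒜 ≤ d)
    (S : Finset α) (𝒱 : Finset (Finset α))
    (h𝒱 : ∀ t ∈ 𝒱, t ⊆ S ∧ ∃ A ∈ 𝒜, ∀ a ∈ S, a ∈ A ↔ a ∈ t) :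
    𝒱.card ≤ ∑ i ∈ Finset.range (d + 1), S.card.choose i := by
  have hsub : 𝒱.shatterer ⊆ (Finset.range (d + 1)).biUnion fun i => S.powersetCard i := by
    intro U hU
    rw [Finset.mem_shatterer] at hU
    have hUS : U ⊆ S := by
      obtain ⟨t, ht, hUt⟩ := hU.exists_superset
      exact hUt.trans (h𝒱 t ht).1
    have hsh : Shatters 𝒜 U := by
      intro t ht
      obtain ⟨u, hu, rfl⟩ := hU ht
      obtain ⟨-, A, hA, hAu⟩ := h𝒱 u hu
      refine ⟨A, hA, fun a ha => ?_⟩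
      rw [hAu a (hUS ha), Finset.mem_inter]
      tauto
    simp only [Finset.mem_biUnion, Finset.mem_range, Finset.mem_powersetCard]
    exact ⟨U.card, Nat.lt_succ_of_le (card_le_of_shatters h hsh), hUS, rfl⟩
  calc 𝒱.card ≤ 𝒱.shatterer.card := Finset.card_le_card_shatterer 𝒱
    _ ≤ _ := Finset.card_le_card hsub
    _ ≤ ∑ i ∈ Finset.range (d + 1), (S.powersetCard i).card := Finset.card_biUnion_le
    _ = _ := by simp only [Finset.card_powersetCard]

lemma sum_choose_le_exp (k d : ℕ) {x : ℝ} (hx : 0 < x) (hx1 : x ≤ 1) :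
    (∑ i ∈ Finset.range (d + 1), (k.choose i : ℝ)) * x ^ d ≤ Real.exp (x * k) := by
  have h1 : (∑ i ∈ Finset.range (d + 1), (k.choose i : ℝ)) * x ^ d
      ≤ ∑ i ∈ Finset.range (d + 1), (k.choose i : ℝ) * x ^ i := by
    rw [Finset.sum_mul]
    refine Finset.sum_le_sum fun i hi => ?_
    gcongr ?_ * ?_
    exact pow_le_pow_of_le_one hx.le hx1 (Nat.lt_succ_iff.mp (Finset.mem_range.mp hi))
  have h2 : ∑ i ∈ Finset.range (d + 1), (k.choose i : ℝ) * x ^ i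
      ≤ ∑ i ∈ Finset.range (max d k + 1), (k.choose i : ℝ) * x ^ i := by
    refine Finset.sum_le_sum_of_subset_of_nonneg ?_ fun _ _ _ => by positivity
    exact Finset.range_mono (by omega)
  have h3 : ∑ i ∈ Finset.range (max d k + 1), (k.choose i : ℝ) * x ^ i
      = ∑ i ∈ Finset.range (k + 1), (k.choose i : ℝ) * x ^ i := by
    symm
    refine Finset.sum_subset (Finset.range_mono (by omega)) fun i _ hi => ?_
    rw [Nat.choose_eq_zero_of_lt (by simpa using hi)]
    simp
  have h4 : ∑ i ∈ Finset.range (k + 1), (k.choose i : ℝ) * x ^ i = (x + 1) ^ k := by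
    rw [add_pow]
    exact Finset.sum_congr rfl fun i _ => by ring
  calc _ ≤ (x + 1) ^ k := h1.trans (h2.trans (h3.trans h4).le)
    _ ≤ (Real.exp x) ^ k := by gcongr; exact Real.add_one_le_exp x
    _ = Real.exp (x * k) := by rw [← Real.exp_nat_mul]; ring_nf

open Classical in
/-- If every `w ∈ W` is hit by a proportion at least `β` of the points of `Q`, some `k` points miss
at most a proportion `(1 - β) ^ k` of `W`: add the points greedily. -/
lemma exists_hitting_finset {γ Q : Type*} [Fintype Q] [Nonempty Q] (W : Finset γ)
    (R : γ → Q → Prop) {β : ℝ} (hβ : β ≤ 1)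
    (h : ∀ w ∈ W, β * Fintype.card Q ≤ (Finset.univ.filter (R w)).card) (k : ℕ) :
    ∃ T : Finset Q, T.card ≤ k ∧
      ((W.filter fun w => ∀ q ∈ T, ¬ R w q).card : ℝ) ≤ (1 - β) ^ k * W.card := by
  induction k with
  | zero => exact ⟨∅, by simp, by simp⟩
  | succ k ih =>
    obtain ⟨T, hT, hW⟩ := ih
    set W' := W.filter fun w => ∀ q ∈ T, ¬ R w q with hW'
    have hswap : ∑ q : Q, ((W'.filter fun w => R w q).card : ℝ)
        = ∑ w ∈ W', ((Finset.univ.filter (R w)).card : ℝ) := by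
      simp only [Finset.card_filter, Nat.cast_sum]
      exact Finset.sum_comm
    obtain ⟨q, -, hq⟩ : ∃ q ∈ (Finset.univ : Finset Q),
        β * W'.card ≤ ((W'.filter fun w => R w q).card : ℝ) := by
      refine Finset.exists_le_of_sum_le Finset.univ_nonempty ?_
      rw [hswap]
      calc ∑ _q : Q, β * (W'.card : ℝ) = ∑ w ∈ W', β * Fintype.card Q := by
            simp only [Finset.sum_const, Finset.card_univ, nsmul_eq_mul]; ring
        _ ≤ _ := Finset.sum_le_sum fun w hw => h w (Finset.mem_filter.mp hw).1
    refine ⟨insert q T, (Finset.card_insert_le q T).trans (by omega), ?_⟩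
    have heq : (W.filter fun w => ∀ q' ∈ insert q T, ¬ R w q') = W'.filter fun w => ¬ R w q := by
      ext w
      simp only [hW', Finset.mem_filter, Finset.mem_insert, forall_eq_or_imp]
      tauto
    have hsplit := Finset.card_filter_add_card_filter_not (s := W') (fun w => R w q)
    have hsplit' : ((W'.filter fun w => R w q).card : ℝ) + (W'.filter fun w => ¬ R w q).card
        = W'.card := by exact_mod_cast hsplit
    rw [heq]
    calc ((W'.filter fun w => ¬ R w q).card : ℝ) ≤ (1 - β) * W'.card := by linarith
      _ ≤ (1 - β) * ((1 - β) ^ k * W.card) := by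
          exact mul_le_mul_of_nonneg_left hW (by linarith)
      _ = _ := by ring

/-- If every `w ∈ W` is hit by a proportion at least `β` of the points of `Q`, about `log |W| / β`
points hit all of `W`. -/
lemma exists_hitting_finset_of_lt {γ Q : Type*} [Fintype Q] [Nonempty Q] (W : Finset γ)
    (R : γ → Q → Prop) [∀ w, DecidablePred (R w)] {β : ℝ} (hβ : β ≤ 1)
    (h : ∀ w ∈ W, β * Fintype.card Q ≤ (Finset.univ.filter (R w)).card) {k : ℕ} {L : ℝ}
    (hL : L ≤ β * k) (hW : (W.card : ℝ) < Real.exp L) :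
    ∃ T : Finset Q, T.card ≤ k ∧ ∀ w ∈ W, ∃ q ∈ T, R w q := by
  classical
  obtain ⟨T, hT, hTW⟩ := exists_hitting_finset W R hβ
    (fun w hw => (h w hw).trans (le_of_eq (by congr!))) k
  refine ⟨T, hT, fun w hw => ?_⟩
  by_contra! hmiss
  have h1 : (1 : ℝ) ≤ (W.filter fun w => ∀ q ∈ T, ¬ R w q).card := by
    exact_mod_cast Finset.card_pos.mpr ⟨w, Finset.mem_filter.mpr ⟨hw, hmiss⟩⟩
  have h2 : (1 - β) ^ k ≤ Real.exp (-L) := by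
    calc (1 - β) ^ k ≤ (Real.exp (-β)) ^ k := by
          gcongr
          have := Real.add_one_le_exp (-β); linarith
      _ = Real.exp (-(β * k)) := by rw [← Real.exp_nat_mul]; ring_nf
      _ ≤ _ := Real.exp_le_exp.mpr (by linarith)
  have h3 : (1 - β) ^ k * (W.card : ℝ) < 1 := by
    calc (1 - β) ^ k * (W.card : ℝ) ≤ Real.exp (-L) * W.card := by gcongr
      _ < Real.exp (-L) * Real.exp L := by gcongr
      _ = 1 := by rw [← Real.exp_add]; simp
  exact absurd (h1.trans (le_trans (le_of_eq (by congr!)) hTW)) (not_le.mpr h3)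

open Classical in
/-- Among the thresholds `l / M`, about `M * |a - b|` separate the reals `a, b ∈ [0, 1]`. -/
lemma card_separating_thresholds {M : ℕ} (hM : 0 < M) {a b : ℝ} (ha : a ∈ Set.Icc (0 : ℝ) 1)
    (hb : b ∈ Set.Icc (0 : ℝ) 1) :
    M * |a - b| - 1 ≤ ((Finset.univ.filter fun l : Fin M =>
      ¬ ((l : ℝ) / M < a ↔ (l : ℝ) / M < b)).card : ℝ) := by
  wlog hab : b ≤ a generalizing a b
  · have := this hb ha (le_of_not_ge hab)
    rw [abs_sub_comm]
    refine this.trans (le_of_eq ?_)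
    congr 2
    ext l
    simp only [Finset.mem_filter]
    tauto
  have hM' : (0 : ℝ) < M := by exact_mod_cast hM
  have hle : ⌈a * M⌉₊ ≤ M := Nat.ceil_le.mpr (by nlinarith [ha.2])
  have hsub : (Finset.Ico ⌈b * M⌉₊ ⌈a * M⌉₊) ⊆ (Finset.univ.filter fun l : Fin M =>
      ¬ ((l : ℝ) / M < a ↔ (l : ℝ) / M < b)).image (fun l : Fin M => (l : ℕ)) := by
    intro l hl
    rw [Finset.mem_Ico] at hl
    have hl1 : b * M ≤ l := Nat.ceil_le.mp hl.1
    have hl2 : (l : ℝ) < a * M := Nat.lt_ceil.mp hl.2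
    refine Finset.mem_image.mpr ⟨⟨l, hl.2.trans_le hle⟩, ?_, rfl⟩
    have h1 : (l : ℝ) / M < a := by rwa [div_lt_iff₀ hM']
    have h2 : ¬ (l : ℝ) / M < b := by rw [div_lt_iff₀ hM']; exact not_lt.mpr hl1
    simp [h1, h2]
  have hcard := (Finset.card_le_card hsub).trans Finset.card_image_le
  rw [Nat.card_Ico] at hcard
  have hc1 : (⌈a * M⌉₊ : ℝ) - ⌈b * M⌉₊ ≤ ((⌈a * M⌉₊ - ⌈b * M⌉₊ : ℕ) : ℝ) := by
    rw [sub_le_iff_le_add]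
    exact_mod_cast le_tsub_add
  have hc2 : ((⌈a * M⌉₊ - ⌈b * M⌉₊ : ℕ) : ℝ) ≤ ((Finset.univ.filter fun l : Fin M =>
      ¬ ((l : ℝ) / M < a ↔ (l : ℝ) / M < b)).card : ℝ) := by exact_mod_cast hcard
  have h3 := Nat.le_ceil (a * M)
  have h4 := Nat.ceil_lt_add_one (mul_nonneg hb.1 hM'.le)
  rw [abs_of_nonneg (by linarith)]
  nlinarith

lemma log_one_add_two_mul_le {u : ℝ} (hu : 0 ≤ u) : Real.log (1 + 2 * u) ≤ u / 2 + 1 := by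
  have h1 : Real.log ((1 + 2 * u) / 4) ≤ (1 + 2 * u) / 4 - 1 :=
    Real.log_le_sub_one_of_pos (by positivity)
  rw [Real.log_div (by positivity) (by norm_num), show (4 : ℝ) = 2 ^ 2 by norm_num,
    Real.log_pow] at h1
  have := Real.log_two_lt_d9
  push_cast at h1
  linarith

/-- Functions with values in `[0, 1]` that are pairwise `ρ`-separated in the `L¹` distance of the
empirical measure on the points `pt p` are already told apart by the traces of their subgraphs on
few points with thresholds, the number depending on the number of functions but not on the number of
points. -/
lemma exists_separating_finset {ι E P : Type*} [Fintype P] [Nonempty P] {f : ι → E → ℝ}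
    (hf : ∀ i e, f i e ∈ Set.Icc (0 : ℝ) 1) (pt : P → E)
    {ρ : ℝ} (hρ : 0 < ρ) (hρ1 : ρ ≤ 1) (V : Finset ι) (hN : 0 < V.card)
    (hV : ∀ i ∈ V, ∀ j ∈ V, i ≠ j →
      ρ * Fintype.card P ≤ ∑ p, |f i (pt p) - f j (pt p)|) :
    ∃ T : Finset (E × ℝ), (T.card : ℝ) ≤ 4 * Real.log V.card / ρ + 1 ∧
      ∀ i ∈ V, ∀ j ∈ V, i ≠ j → ∃ a ∈ T, ¬ (a.2 < f i a.1 ↔ a.2 < f j a.1) := by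
  classical
  have hN' : (1 : ℝ) ≤ V.card := by exact_mod_cast hN
  have hL0 : 0 ≤ Real.log V.card := Real.log_nonneg hN'
  obtain ⟨M, hMρ⟩ := exists_nat_ge (2 / ρ)
  have hM0 : 0 < M := by
    have : (0 : ℝ) < M := lt_of_lt_of_le (by positivity) hMρ
    exact_mod_cast this
  have : Nonempty (Fin M) := ⟨⟨0, hM0⟩⟩
  have hhit : ∀ w ∈ V.offDiag, ρ / 2 * Fintype.card (P × Fin M) ≤
      ((Finset.univ.filter fun q : P × Fin M => ¬ ((q.2 : ℝ) / M < f w.1 (pt q.1) ↔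
        (q.2 : ℝ) / M < f w.2 (pt q.1))).card : ℝ) := by
    rintro ⟨i, j⟩ hw
    rw [Finset.mem_offDiag] at hw
    have hsum : ((Finset.univ.filter fun q : P × Fin M => ¬ ((q.2 : ℝ) / M < f i (pt q.1) ↔
        (q.2 : ℝ) / M < f j (pt q.1))).card : ℝ) = ∑ p : P,
        ((Finset.univ.filter fun l : Fin M =>
          ¬ ((l : ℝ) / M < f i (pt p) ↔ (l : ℝ) / M < f j (pt p))).card : ℝ) := by
      simp only [Finset.card_filter, Nat.cast_sum, Fintype.sum_prod_type]
    refine le_of_le_of_eq ?_ hsum.symm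
    rw [Fintype.card_prod, Fintype.card_fin]
    have hsep := hV i hw.1 j hw.2.1 hw.2.2
    have hMρ' : 2 ≤ M * ρ := by rwa [div_le_iff₀ hρ] at hMρ
    have hP : (0 : ℝ) ≤ Fintype.card P := by positivity
    calc ρ / 2 * ((Fintype.card P * M : ℕ) : ℝ)
        ≤ M * (ρ * Fintype.card P) - Fintype.card P := by
          push_cast
          nlinarith
      _ ≤ M * (∑ p, |f i (pt p) - f j (pt p)|) - Fintype.card P := by gcongr
      _ = ∑ p, (M * |f i (pt p) - f j (pt p)| - 1) := by
          rw [Finset.sum_sub_distrib, Finset.mul_sum]; simp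
      _ ≤ _ := Finset.sum_le_sum fun p _ =>
          (card_separating_thresholds hM0 (hf _ _) (hf _ _)).trans (le_of_eq (by congr!))
  have hoff : (V.offDiag.card : ℝ) < Real.exp (2 * Real.log V.card) := by
    rw [two_mul, Real.exp_add, Real.exp_log (by linarith), Finset.offDiag_card]
    have : V.card * V.card - V.card < V.card * V.card := by
      have := Nat.mul_pos hN hN
      omega
    exact_mod_cast this
  obtain ⟨T, hTk, hT⟩ := exists_hitting_finset_of_lt V.offDiag (fun w (q : P × Fin M) =>
      ¬ ((q.2 : ℝ) / M < f w.1 (pt q.1) ↔ (q.2 : ℝ) / M < f w.2 (pt q.1)))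
    (β := ρ / 2) (by linarith) (fun w hw => (hhit w hw).trans (le_of_eq (by congr!)))
    (k := ⌈4 * Real.log V.card / ρ⌉₊) (L := 2 * Real.log V.card)
    (by
      have := Nat.le_ceil (4 * Real.log V.card / ρ)
      rw [div_le_iff₀ hρ] at this
      linarith) hoff
  refine ⟨T.image fun q => (pt q.1, (q.2 : ℝ) / M), ?_, fun i hi j hj hij => ?_⟩
  · calc ((T.image fun q => (pt q.1, (q.2 : ℝ) / M)).card : ℝ)
        ≤ ⌈4 * Real.log V.card / ρ⌉₊ := by exact_mod_cast Finset.card_image_le.trans hTk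
      _ ≤ _ := (Nat.ceil_lt_add_one (by positivity)).le
  · obtain ⟨q, hq, hqR⟩ := hT (i, j) (Finset.mem_offDiag.mpr ⟨hi, hj, hij⟩)
    exact ⟨_, Finset.mem_image_of_mem _ hq, hqR⟩

/-- Solving `N ≤ ∑ i ≤ d, k.choose i` for `N` when `k` itself is of order `log N / β`. -/
lemma log_le_of_le_sum_choose {N k d : ℕ} {β : ℝ} (hd : 1 ≤ d) (hN : 1 ≤ N) (hβ : 0 < β)
    (hβ1 : β ≤ 1) (hk : (k : ℝ) ≤ 2 * Real.log N / β + 1)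
    (h : N ≤ ∑ i ∈ Finset.range (d + 1), k.choose i) :
    Real.log N ≤ d * (2 * Real.log (1 / β) + 4) := by
  have hd1 : (1 : ℝ) ≤ d := by exact_mod_cast hd
  have hd' : (0 : ℝ) < d := by linarith
  have hN' : (1 : ℝ) ≤ N := by exact_mod_cast hN
  have hL0 : 0 ≤ Real.log N := Real.log_nonneg hN'
  obtain ⟨u, hu⟩ : ∃ u : ℝ, Real.log N = d * u := ⟨Real.log N / d, by field_simp⟩
  have hu0 : 0 ≤ u := by
    rw [hu] at hL0
    exact nonneg_of_mul_nonneg_right hL0 hd'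
  have hden : 1 ≤ 1 + 2 * u / β := by
    have : 0 ≤ 2 * u / β := by positivity
    linarith
  -- The choice `x ≈ d / k` balances the two factors in `sum_choose_le_exp`.
  obtain ⟨x, hx⟩ : ∃ x : ℝ, x = (1 + 2 * u / β)⁻¹ := ⟨_, rfl⟩
  have hx0 : 0 < x := by rw [hx]; positivity
  have hx1 : x ≤ 1 := hx ▸ inv_le_one_of_one_le₀ hden
  have hxk : x * k ≤ d := by
    rw [hx, inv_mul_le_iff₀ (by positivity)]
    have h2 : (1 + 2 * u / β) * d = d + 2 * Real.log N / β := by rw [hu]; field_simp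
    rw [h2]; linarith
  have hlog : Real.log N + d * Real.log x ≤ d := by
    rw [← Real.log_pow, ← Real.log_mul (by positivity) (by positivity),
      Real.log_le_iff_le_exp (by positivity)]
    have h' : (N : ℝ) ≤ ∑ i ∈ Finset.range (d + 1), (k.choose i : ℝ) := by exact_mod_cast h
    calc (N : ℝ) * x ^ d ≤ (∑ i ∈ Finset.range (d + 1), (k.choose i : ℝ)) * x ^ d := by gcongr
      _ ≤ _ := sum_choose_le_exp k d hx0 hx1
      _ ≤ _ := Real.exp_le_exp.mpr hxk
  have hlogx : -Real.log x ≤ Real.log (1 / β) + (u / 2 + 1) := by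
    rw [hx, Real.log_inv, neg_neg]
    have h1 : 1 + 2 * u / β ≤ (1 / β) * (1 + 2 * u) := by
      have h2 : 1 ≤ 1 / β := by rw [le_div_iff₀ hβ]; linarith
      have : 2 * u / β = (1 / β) * (2 * u) := by field_simp
      rw [this]; linarith
    calc _ ≤ Real.log ((1 / β) * (1 + 2 * u)) := Real.log_le_log (by positivity) h1
      _ = Real.log (1 / β) + Real.log (1 + 2 * u) :=
          Real.log_mul (by positivity) (by positivity)
      _ ≤ _ := by gcongr; exact log_one_add_two_mul_le hu0
  have h5 : d * -Real.log x ≤ d * (Real.log (1 / β) + (u / 2 + 1)) := by gcongr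
  nlinarith

/-- Packing bound for a class of `[0, 1]`-valued functions whose subgraphs have VC dimension at most
`d`, in an empirical `L¹` distance. The bound does not depend on the number of points: it results
from Sauer-Shelah on a separating set whose size is of order `log N / ρ`. -/
lemma log_card_separated_le {ι E P : Type*} [Fintype P] [Nonempty P] {f : ι → E → ℝ}
    (hf : ∀ i e, f i e ∈ Set.Icc (0 : ℝ) 1) (pt : P → E) {d : ℕ} (hd : 1 ≤ d)
    (h : vcDim (Set.range fun i : ι => {a : E × ℝ | a.2 < f i a.1}) ≤ d)
    {ρ : ℝ} (hρ : 0 < ρ) (hρ1 : ρ ≤ 1) (V : Finset ι)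
    (hV : ∀ i ∈ V, ∀ j ∈ V, i ≠ j →
      ρ * Fintype.card P ≤ ∑ p, |f i (pt p) - f j (pt p)|) :
    Real.log V.card ≤ d * (2 * Real.log (2 / ρ) + 4) := by
  classical
  rcases Nat.eq_zero_or_pos V.card with hN0 | hN
  · have hlogρ : 0 ≤ Real.log (2 / ρ) := Real.log_nonneg (by rw [le_div_iff₀ hρ]; linarith)
    rw [hN0]; simp; positivity
  obtain ⟨T, hTk, hT⟩ := exists_separating_finset hf pt hρ hρ1 V hN hV
  have hinj : Set.InjOn (fun i => T.filter fun a => a.2 < f i a.1) V := by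
    intro i hi j hj hij
    by_contra hne
    obtain ⟨a, ha, hna⟩ := hT i hi j hj hne
    have hmem := Finset.ext_iff.mp hij a
    simp only [Finset.mem_filter, ha, true_and] at hmem
    exact hna hmem
  have hsauer := card_traces_le h T (V.image fun i => T.filter fun a => a.2 < f i a.1) (by
    intro t ht
    obtain ⟨i, -, rfl⟩ := Finset.mem_image.mp ht
    refine ⟨Finset.filter_subset _ _, _, ⟨i, rfl⟩, fun a ha => ?_⟩
    simp [ha])
  rw [Finset.card_image_of_injOn hinj] at hsauer
  have := log_le_of_le_sum_choose (β := ρ / 2) hd hN (by positivity) (by linarith)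
    (hTk.trans (le_of_eq (by field_simp; ring))) hsauer
  rwa [one_div_div] at this

/-- A class of `[0, 1]`-valued functions with subgraphs of VC dimension at most `d` has, in the
empirical `L¹` distance, a finite `ρ`-net whose size depends on `d` and `ρ` only. -/
lemma exists_net {ι E P : Type*} [Fintype P] [Nonempty P] {f : ι → E → ℝ}
    (hf : ∀ i e, f i e ∈ Set.Icc (0 : ℝ) 1) (pt : P → E) {d : ℕ} (hd : 1 ≤ d)
    (h : vcDim (Set.range fun i : ι => {a : E × ℝ | a.2 < f i a.1}) ≤ d)
    {ρ : ℝ} (hρ : 0 < ρ) (hρ1 : ρ ≤ 1) (F : Finset ι) :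
    ∃ V ⊆ F, Real.log V.card ≤ d * (2 * Real.log (2 / ρ) + 4) ∧
      ∀ i ∈ F, ∃ j ∈ V, ∑ p, |f i (pt p) - f j (pt p)| ≤ ρ * Fintype.card P := by
  classical
  set sep : Finset ι → Prop := fun V => ∀ i ∈ V, ∀ j ∈ V, i ≠ j →
      ρ * Fintype.card P ≤ ∑ p, |f i (pt p) - f j (pt p)| with hsep
  obtain ⟨V, hV, hmax⟩ := Finset.exists_max_image (F.powerset.filter sep) Finset.card
    ⟨∅, by simp [hsep]⟩
  rw [Finset.mem_filter, Finset.mem_powerset] at hV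
  refine ⟨V, hV.1, log_card_separated_le hf pt hd h hρ hρ1 V hV.2, fun i hi => ?_⟩
  by_contra! hfar
  have hiV : i ∉ V := by
    intro hiV
    have := hfar i hiV
    simp only [sub_self, abs_zero, Finset.sum_const_zero] at this
    exact absurd this (not_lt.mpr (by positivity))
  have hnew : insert i V ∈ F.powerset.filter sep := by
    rw [Finset.mem_filter, Finset.mem_powerset]
    refine ⟨Finset.insert_subset hi hV.1, fun a ha b hb hab => ?_⟩
    rcases Finset.mem_insert.mp ha with rfl | ha'
    · rcases Finset.mem_insert.mp hb with rfl | hb'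
      · exact absurd rfl hab
      · exact (hfar b hb').le
    · rcases Finset.mem_insert.mp hb with rfl | hb'
      · simpa only [abs_sub_comm] using (hfar a ha').le
      · exact hV.2 a ha' b hb' hab
  have := hmax _ hnew
  rw [Finset.card_insert_of_notMem hiV] at this
  omega

/-! ### Entropy and mutual information -/

lemma negMulLog_le_linear {u ε : ℝ} (hu : 0 ≤ u) (hε : 0 < ε) :
    Real.negMulLog u ≤ -Real.log ε * u + ε := by
  have h := Real.negMulLog_le_one_sub_self (div_nonneg hu hε.le)
  have h2 : Real.negMulLog u = Real.negMulLog (u / ε * ε) := by rw [div_mul_cancel₀ _ hε.ne']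
  rw [h2, Real.negMulLog_mul, show Real.negMulLog ε = -ε * Real.log ε from rfl]
  have h3 : ε * Real.negMulLog (u / ε) ≤ ε * (1 - u / ε) := by gcongr
  have h4 : ε * (u / ε) = u := by field_simp
  have h5 : u / ε * (-ε * Real.log ε) = -Real.log ε * u := by field_simp
  rw [h5]
  nlinarith

lemma negMulLog_add_le {a b : ℝ} (ha : 0 ≤ a) (hb : 0 ≤ b) :
    Real.negMulLog (a + b) ≤ Real.negMulLog a + Real.negMulLog b := by
  have key : ∀ {x y : ℝ}, 0 ≤ x → 0 ≤ y → x * Real.log x ≤ x * Real.log (x + y) := by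
    intro x y hx hy
    rcases hx.eq_or_lt with rfl | hx'
    · simp
    · gcongr
      linarith
  have h1 := key ha hb
  have h2 := key hb ha
  rw [add_comm b a] at h2
  simp only [Real.negMulLog]
  linarith

lemma negMulLog_sub_le {a b : ℝ} (hb : 0 ≤ b) (hab : b ≤ a) (ha : a ≤ 1) :
    Real.negMulLog b - Real.negMulLog a ≤ a - b := by
  have ha0 : 0 ≤ a := hb.trans hab
  have hla : Real.log a ≤ 0 := Real.log_nonpos ha0 ha
  rcases ha0.eq_or_lt with h0 | hapos
  · have : b = 0 := by linarith
    rw [← h0, this]; simp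
  have h := Real.negMulLog_le_one_sub_self (div_nonneg hb ha0)
  have h2 : Real.negMulLog b = Real.negMulLog (b / a * a) := by rw [div_mul_cancel₀ _ hapos.ne']
  rw [h2, Real.negMulLog_mul]
  have h3 : a * Real.negMulLog (b / a) ≤ a * (1 - b / a) := by gcongr
  have h4 : a * (1 - b / a) = a - b := by field_simp
  have h5 : b / a * Real.negMulLog a ≤ Real.negMulLog a := by
    have : b / a ≤ 1 := by rw [div_le_one hapos]; exact hab
    exact mul_le_of_le_one_left (Real.negMulLog_nonneg ha0 ha) this
  linarith

/-- A Lipschitz bound with slack `ε` for `x ↦ -x log x`, whose slope at `0` is infinite. -/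
lemma abs_negMulLog_sub_le {a b ε : ℝ} (ha : a ∈ Set.Icc (0 : ℝ) 1) (hb : b ∈ Set.Icc (0 : ℝ) 1)
    (hε : 0 < ε) (hlog : 1 ≤ -Real.log ε) :
    |Real.negMulLog a - Real.negMulLog b| ≤ -Real.log ε * |a - b| + ε := by
  wlog hab : b ≤ a generalizing a b
  · rw [abs_sub_comm, abs_sub_comm a b]
    exact this hb ha (le_of_not_ge hab)
  have hu : 0 ≤ a - b := by linarith
  rw [abs_of_nonneg hu, abs_le]
  constructor
  · have h1 := negMulLog_sub_le hb.1 hab ha.2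
    nlinarith
  · have h1 := negMulLog_add_le hb.1 hu
    have h2 := negMulLog_le_linear hu hε
    rw [add_sub_cancel] at h1
    linarith

/-- The conditional law of `A` given `B = b`; the junk value `0 / 0 = 0` at a null `b` is harmless,
as it still lies in `[0, 1]`. -/
lemma conditional_mem_Icc {A B : Type*} [Fintype A] {q : A → B → ℝ}
    (hq : ∀ a b, 0 ≤ q a b) (a : A) (b : B) :
    q a b / ∑ a', q a' b ∈ Set.Icc (0 : ℝ) 1 := by
  have h0 : 0 ≤ ∑ a', q a' b := Finset.sum_nonneg fun a' _ => hq a' b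
  refine ⟨div_nonneg (hq a b) h0, div_le_one_of_le₀ ?_ h0⟩
  exact Finset.single_le_sum (f := fun a' => q a' b) (fun a' _ => hq a' b) (Finset.mem_univ a)

section FiniteDistributions

variable {A B : Type*} [Fintype A] [Fintype B]

lemma abs_entropy_sub_le {p p' : A → ℝ} {ε : ℝ} (hp : ∀ a, p a ∈ Set.Icc (0 : ℝ) 1)
    (hp' : ∀ a, p' a ∈ Set.Icc (0 : ℝ) 1) (hε : 0 < ε) (hlog : 1 ≤ -Real.log ε) :
    |entropy p - entropy p'| ≤ -Real.log ε * ∑ a, |p a - p' a| + Fintype.card A * ε := by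
  rw [entropy, entropy, ← Finset.sum_sub_distrib]
  refine (Finset.abs_sum_le_sum_abs _ _).trans ?_
  refine (Finset.sum_le_sum fun a _ => abs_negMulLog_sub_le (hp a) (hp' a) hε hlog).trans ?_
  rw [Finset.sum_add_distrib, ← Finset.mul_sum]
  simp

lemma entropy_nonneg {p : A → ℝ} (hp : ∀ a, p a ∈ Set.Icc (0 : ℝ) 1) : 0 ≤ entropy p :=
  Finset.sum_nonneg fun a _ => Real.negMulLog_nonneg (hp a).1 (hp a).2

lemma mem_Icc_of_sum_eq_one {p : A → ℝ} (hp : ∀ a, 0 ≤ p a) (hsum : ∑ a, p a = 1) (a : A) :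
    p a ∈ Set.Icc (0 : ℝ) 1 :=
  ⟨hp a, hsum ▸ Finset.single_le_sum (fun a _ => hp a) (Finset.mem_univ a)⟩

lemma entropy_le_log_card {p : A → ℝ} (hp : ∀ a, 0 ≤ p a) (hsum : ∑ a, p a = 1) :
    entropy p ≤ Real.log (Fintype.card A) := by
  have hA : Nonempty A := by
    by_contra hA
    rw [not_nonempty_iff] at hA
    simp at hsum
  have hN : (0 : ℝ) < Fintype.card A := by exact_mod_cast Fintype.card_pos
  set N : ℝ := (Fintype.card A : ℝ)
  have h : ∀ a, N * Real.negMulLog (p a) ≤ 1 - N * p a + p a * (N * Real.log N) := by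
    intro a
    have h1 := Real.negMulLog_le_one_sub_self (mul_nonneg hN.le (hp a))
    rw [Real.negMulLog_mul, show Real.negMulLog N = -N * Real.log N from rfl] at h1
    linarith
  have h2 : N * entropy p ≤ N * Real.log N := by
    rw [entropy, Finset.mul_sum]
    refine (Finset.sum_le_sum fun a _ => h a).trans (le_of_eq ?_)
    rw [Finset.sum_add_distrib, Finset.sum_sub_distrib, ← Finset.mul_sum, ← Finset.sum_mul, hsum]
    simp [N]
  exact le_of_mul_le_mul_left h2 hN

lemma abs_mutualInfo_le {q : A → B → ℝ} (hq : ∀ a b, 0 ≤ q a b) (hsum : ∑ a, ∑ b, q a b = 1) :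
    |mutualInfo q| ≤ Real.log (Fintype.card A) := by
  have hm0 : ∀ a, 0 ≤ ∑ b, q a b := fun a => Finset.sum_nonneg fun b _ => hq a b
  have h1 := entropy_nonneg (mem_Icc_of_sum_eq_one hm0 hsum)
  have h2 := entropy_le_log_card hm0 hsum
  have h3 : 0 ≤ ∑ b, (∑ a, q a b) * entropy (fun a => q a b / ∑ a', q a' b) :=
    Finset.sum_nonneg fun b _ => mul_nonneg (Finset.sum_nonneg fun a _ => hq a b)
      (entropy_nonneg fun a => conditional_mem_Icc hq a b)
  have h4 : ∑ b, (∑ a, q a b) * entropy (fun a => q a b / ∑ a', q a' b)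
      ≤ ∑ b, (∑ a, q a b) * Real.log (Fintype.card A) := by
    refine Finset.sum_le_sum fun b _ => ?_
    rcases (Finset.sum_nonneg fun a _ => hq a b : 0 ≤ ∑ a, q a b).eq_or_lt with h0 | hpos
    · rw [← h0]; simp
    · refine mul_le_mul_of_nonneg_left (entropy_le_log_card
        (fun a => (conditional_mem_Icc hq a b).1) ?_) hpos.le
      rw [← Finset.sum_div, div_self hpos.ne']
  rw [← Finset.sum_mul, Finset.sum_comm, hsum, one_mul] at h4
  rw [mutualInfo, abs_le]
  constructor <;> linarith

/-- Mutual information is Lipschitz, with slack, in the `L¹` distance of joint distributions with a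
common second marginal. -/
lemma abs_mutualInfo_sub_le {q q' : A → B → ℝ} (hq : ∀ a b, 0 ≤ q a b) (hq' : ∀ a b, 0 ≤ q' a b)
    (hsum : ∑ a, ∑ b, q a b = 1) (hmarg : ∀ b, ∑ a, q a b = ∑ a, q' a b) {ε : ℝ} (hε : 0 < ε)
    (hlog : 1 ≤ -Real.log ε) :
    |mutualInfo q - mutualInfo q'| ≤
      2 * (-Real.log ε * ∑ a, ∑ b, |q a b - q' a b| + Fintype.card A * ε) := by
  have hsum' : ∑ a, ∑ b, q' a b = 1 := by
    rw [← hsum, Finset.sum_comm, Finset.sum_comm (f := fun a b => q a b)]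
    exact Finset.sum_congr rfl fun b _ => (hmarg b).symm
  have hm0 : ∀ a, 0 ≤ ∑ b, q a b := fun a => Finset.sum_nonneg fun b _ => hq a b
  have hm0' : ∀ a, 0 ≤ ∑ b, q' a b := fun a => Finset.sum_nonneg fun b _ => hq' a b
  have h1 := abs_entropy_sub_le (mem_Icc_of_sum_eq_one hm0 hsum)
    (mem_Icc_of_sum_eq_one hm0' hsum') hε hlog
  have h1' : ∑ a, |(∑ b, q a b) - ∑ b, q' a b| ≤ ∑ a, ∑ b, |q a b - q' a b| := by
    refine Finset.sum_le_sum fun a _ => ?_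
    rw [← Finset.sum_sub_distrib]
    exact Finset.abs_sum_le_sum_abs _ _
  have h2 : |(∑ b, (∑ a, q a b) * entropy (fun a => q a b / ∑ a', q a' b)) -
      ∑ b, (∑ a, q' a b) * entropy (fun a => q' a b / ∑ a', q' a' b)| ≤
      -Real.log ε * ∑ a, ∑ b, |q a b - q' a b| + Fintype.card A * ε := by
    rw [← Finset.sum_sub_distrib]
    refine (Finset.abs_sum_le_sum_abs _ _).trans ?_
    have hb : ∀ b ∈ (Finset.univ : Finset B),
        |(∑ a, q a b) * entropy (fun a => q a b / ∑ a', q a' b) -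
          (∑ a, q' a b) * entropy (fun a => q' a b / ∑ a', q' a' b)| ≤
        -Real.log ε * ∑ a, |q a b - q' a b| + (∑ a, q a b) * (Fintype.card A * ε) := by
      intro b _
      have h := abs_entropy_sub_le (fun a => conditional_mem_Icc hq a b)
        (fun a => conditional_mem_Icc hq' a b) hε hlog
      rw [← hmarg b] at h ⊢
      rcases (Finset.sum_nonneg fun a _ => hq a b : 0 ≤ ∑ a, q a b).eq_or_lt with h0 | hpos
      · rw [← h0]
        have : 0 ≤ ∑ a, |q a b - q' a b| := Finset.sum_nonneg fun a _ => abs_nonneg _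
        simp only [zero_mul, sub_zero, abs_zero, add_zero]
        exact mul_nonneg (by linarith) this
      · rw [← mul_sub, abs_mul, abs_of_pos hpos]
        refine (mul_le_mul_of_nonneg_left h hpos.le).trans (le_of_eq ?_)
        have hd : ∑ a, |q a b / ∑ a', q a' b - q' a b / ∑ a', q a' b|
            = (∑ a, |q a b - q' a b|) / ∑ a', q a' b := by
          rw [Finset.sum_div]
          refine Finset.sum_congr rfl fun a _ => ?_
          rw [← sub_div, abs_div, abs_of_pos hpos]
        rw [hd]
        field_simp
    refine (Finset.sum_le_sum hb).trans (le_of_eq ?_)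
    rw [Finset.sum_add_distrib, ← Finset.mul_sum, ← Finset.sum_mul]
    rw [Finset.sum_comm (f := fun b a => q a b), hsum, Finset.sum_comm, one_mul]
  have h3 : -Real.log ε * ∑ a, |(∑ b, q a b) - ∑ b, q' a b| ≤
      -Real.log ε * ∑ a, ∑ b, |q a b - q' a b| :=
    mul_le_mul_of_nonneg_left h1' (by linarith)
  rw [mutualInfo, mutualInfo, abs_le]
  rw [abs_le] at h1 h2
  constructor <;> linarith [h1.1, h1.2, h2.1, h2.2]

/-- `I(A; B) = H(A) + H(B) - H(A, B)`. -/
lemma mutualInfo_eq_add_sub {q : A → B → ℝ} (hq : ∀ a b, 0 ≤ q a b) :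
    mutualInfo q = ∑ a, Real.negMulLog (∑ b, q a b) + ∑ b, Real.negMulLog (∑ a, q a b) -
      ∑ a, ∑ b, Real.negMulLog (q a b) := by
  have hb : ∀ b, (∑ a, q a b) * entropy (fun a => q a b / ∑ a', q a' b) =
      ∑ a, Real.negMulLog (q a b) - Real.negMulLog (∑ a, q a b) := by
    intro b
    rcases (Finset.sum_nonneg fun a _ => hq a b : 0 ≤ ∑ a, q a b).eq_or_lt with h0 | hpos
    · have hz : ∀ a, q a b = 0 := fun a =>
        (Finset.sum_eq_zero_iff_of_nonneg fun a _ => hq a b).mp h0.symm a (Finset.mem_univ a)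
      simp [hz]
    · set w := ∑ a, q a b with hw
      have h : ∀ a, w * Real.negMulLog (q a b / w) =
          Real.negMulLog (q a b) - q a b / w * Real.negMulLog w := by
        intro a
        have h2 : Real.negMulLog (q a b) = Real.negMulLog (q a b / w * w) := by
          rw [div_mul_cancel₀ _ hpos.ne']
        rw [h2, Real.negMulLog_mul]
        ring
      rw [entropy, Finset.mul_sum, Finset.sum_congr rfl fun a _ => h a, Finset.sum_sub_distrib,
        ← Finset.sum_mul, ← Finset.sum_div, ← hw, div_self hpos.ne', one_mul]
  rw [mutualInfo, Finset.sum_congr rfl fun b _ => hb b, Finset.sum_sub_distrib, entropy,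
    Finset.sum_comm (f := fun a b => Real.negMulLog (q a b))]
  ring

lemma tendsto_mutualInfo {ι : Type*} {l : Filter ι} {q : ι → A → B → ℝ} {q₀ : A → B → ℝ}
    (hq : ∀ i a b, 0 ≤ q i a b) (hq₀ : ∀ a b, 0 ≤ q₀ a b)
    (h : ∀ a b, Tendsto (fun i => q i a b) l (𝓝 (q₀ a b))) :
    Tendsto (fun i => mutualInfo (q i)) l (𝓝 (mutualInfo q₀)) := by
  rw [mutualInfo_eq_add_sub hq₀]
  simp_rw [fun i => mutualInfo_eq_add_sub (hq i)]
  have hc := Real.continuous_negMulLog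
  refine Tendsto.sub (Tendsto.add ?_ ?_) ?_
  · exact tendsto_finsetSum _ fun a _ => (hc.tendsto _).comp (tendsto_finsetSum _ fun b _ => h a b)
  · exact tendsto_finsetSum _ fun b _ => (hc.tendsto _).comp (tendsto_finsetSum _ fun a _ => h a b)
  · exact tendsto_finsetSum _ fun a _ => tendsto_finsetSum _ fun b _ => (hc.tendsto _).comp (h a b)

lemma measurable_mutualInfo {Ω : Type*} [MeasurableSpace Ω] {q : Ω → A → B → ℝ}
    (hq : ∀ a b, Measurable fun ω => q ω a b) : Measurable fun ω => mutualInfo (q ω) := by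
  have hc := Real.continuous_negMulLog.measurable
  simp only [mutualInfo, entropy]
  refine Measurable.sub ?_ ?_
  · exact Finset.measurable_sum _ fun a _ =>
      hc.comp (Finset.measurable_sum _ fun b _ => hq a b)
  · exact Finset.measurable_sum _ fun b _ => Measurable.mul
      (Finset.measurable_sum _ fun a _ => hq a b)
      (Finset.measurable_sum _ fun a _ => hc.comp
        ((hq a b).div (Finset.measurable_sum _ fun a _ => hq a b)))

end FiniteDistributions

/-! ### The bias of the plug-in estimate -/

section EmpiricalMean

variable {Z : Type*} [MeasurableSpace Z] {m : ℕ}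

/-- The mean of `φ` over the data set `D`. -/
def empiricalMean (φ : Z → ℝ) (D : Fin m → Z) : ℝ :=
  (1 / (m : ℝ)) * ∑ j, φ (D j)

omit [MeasurableSpace Z] in
lemma empiricalMean_mem_Icc {φ : Z → ℝ} (hφ : ∀ z, φ z ∈ Set.Icc (0 : ℝ) 1) (D : Fin m → Z) :
    empiricalMean φ D ∈ Set.Icc (0 : ℝ) 1 := by
  constructor
  · exact mul_nonneg (by positivity) (Finset.sum_nonneg fun j _ => (hφ _).1)
  · have h : ∑ j, φ (D j) ≤ m := by
      refine (Finset.sum_le_sum fun j _ => (hφ (D j)).2).trans (by simp)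
    rw [empiricalMean, one_div_mul_eq_div]
    exact div_le_one_of_le₀ h (by positivity)

omit [MeasurableSpace Z] in
lemma sum_empiricalMean {A : Type*} (s : Finset A) (φ : A → Z → ℝ) (D : Fin m → Z) :
    ∑ a ∈ s, empiricalMean (φ a) D = empiricalMean (fun z => ∑ a ∈ s, φ a z) D := by
  simp only [empiricalMean]
  rw [← Finset.mul_sum, Finset.sum_comm]

lemma measurable_empiricalMean {φ : Z → ℝ} (hφ : Measurable φ) :
    Measurable fun D : Fin m → Z => empiricalMean φ D := by
  unfold empiricalMean
  fun_prop

variable {T : Measure Z} [IsProbabilityMeasure T] {φ : Z → ℝ}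

lemma integrable_of_mem_Icc (hφm : Measurable φ) (hφ : ∀ z, φ z ∈ Set.Icc (0 : ℝ) 1) :
    Integrable φ T :=
  Integrable.of_mem_Icc 0 1 hφm.aemeasurable (ae_of_all _ hφ)

lemma integral_empiricalMean (hm : 1 ≤ m) (hφm : Measurable φ)
    (hφ : ∀ z, φ z ∈ Set.Icc (0 : ℝ) 1) :
    ∫ D : Fin m → Z, empiricalMean φ D ∂(Measure.pi fun _ => T) = ∫ z, φ z ∂T := by
  have hm' : (m : ℝ) ≠ 0 := by positivity
  have hj : ∀ j : Fin m, MeasurePreserving (fun D : Fin m → Z => D j)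
      (Measure.pi fun _ => T) T := fun j => measurePreserving_eval (fun _ => T) j
  have hint := integrable_of_mem_Icc (T := T) hφm hφ
  simp only [empiricalMean]
  rw [integral_const_mul, integral_finsetSum (f := fun (j : Fin m) (D : Fin m → Z) => φ (D j)) _
      fun j _ => (hj j).integrable_comp_of_integrable hint]
  have : ∀ j : Fin m, ∫ D : Fin m → Z, φ (D j) ∂(Measure.pi fun _ => T) = ∫ z, φ z ∂T := by
    intro j
    rw [← (hj j).map_eq, integral_map (hj j).measurable.aemeasurable
      (by rw [(hj j).map_eq]; exact hφm.aestronglyMeasurable), (hj j).map_eq]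
  simp only [this, Finset.sum_const, Finset.card_univ, Fintype.card_fin, nsmul_eq_mul]
  field_simp

lemma integrable_negMulLog_empiricalMean (hφm : Measurable φ)
    (hφ : ∀ z, φ z ∈ Set.Icc (0 : ℝ) 1) :
    Integrable (fun D : Fin m → Z => Real.negMulLog (empiricalMean φ D))
      (Measure.pi fun _ => T) := by
  refine Integrable.of_mem_Icc 0 1 (Real.continuous_negMulLog.measurable.comp
    (measurable_empiricalMean hφm)).aemeasurable (ae_of_all _ fun D => ?_)
  have h := empiricalMean_mem_Icc hφ D
  exact ⟨Real.negMulLog_nonneg h.1 h.2,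
    (Real.negMulLog_le_one_sub_self h.1).trans (by linarith [h.1])⟩

lemma integral_negMulLog_empiricalMean_le (hm : 1 ≤ m) (hφm : Measurable φ)
    (hφ : ∀ z, φ z ∈ Set.Icc (0 : ℝ) 1) :
    ∫ D : Fin m → Z, Real.negMulLog (empiricalMean φ D) ∂(Measure.pi fun _ => T) ≤
      Real.negMulLog (∫ z, φ z ∂T) := by
  rw [← integral_empiricalMean hm hφm hφ]
  exact Real.concaveOn_negMulLog.le_map_integral Real.continuous_negMulLog.continuousOn
    isClosed_Ici (ae_of_all _ fun D => (empiricalMean_mem_Icc hφ D).1)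
    (integrable_of_mem_Icc (measurable_empiricalMean hφm) (empiricalMean_mem_Icc hφ))
    (integrable_negMulLog_empiricalMean hφm hφ)

lemma variance_empiricalMean_le (hm : 1 ≤ m) (hφm : Measurable φ)
    (hφ : ∀ z, φ z ∈ Set.Icc (0 : ℝ) 1) :
    Var[fun D : Fin m → Z => empiricalMean φ D; Measure.pi fun _ => T] ≤ (∫ z, φ z ∂T) / m := by
  have hm' : (0 : ℝ) < m := by positivity
  have hLp : MemLp φ 2 T := memLp_of_bounded (ae_of_all _ hφ) hφm.aestronglyMeasurable 2
  have hv : Var[φ; T] ≤ ∫ z, φ z ∂T := by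
    have h := variance_le_sub_mul_sub (μ := T) (ae_of_all _ hφ) hφm.aemeasurable
    have h0 : 0 ≤ ∫ z, φ z ∂T := integral_nonneg fun z => (hφ z).1
    nlinarith
  have hsum := variance_sum_pi (μ := fun _ : Fin m => T) (X := fun _ => φ) fun _ => hLp
  have heq : (∑ i : Fin m, fun D : Fin m → Z => φ (D i)) = fun D => ∑ i, φ (D i) := by
    ext D; simp
  rw [heq] at hsum
  simp only [empiricalMean]
  rw [variance_const_mul, hsum]
  simp only [Finset.sum_const, Finset.card_univ, Fintype.card_fin, nsmul_eq_mul]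
  rw [show (1 / (m : ℝ)) ^ 2 * (m * Var[φ; T]) = Var[φ; T] / m by field_simp]
  gcongr

/-- The plug-in estimate of `-μ log μ`, where `μ` is the mean of `φ`, is too small by at most
`1 / m` on average. As for the bound of the Kullback-Leibler by the `χ²` divergence, the loss is at
most the variance of the empirical mean divided by `μ`. -/
lemma negMulLog_integral_le (hm : 1 ≤ m) (hφm : Measurable φ)
    (hφ : ∀ z, φ z ∈ Set.Icc (0 : ℝ) 1) :
    Real.negMulLog (∫ z, φ z ∂T) ≤
      ∫ D : Fin m → Z, Real.negMulLog (empiricalMean φ D) ∂(Measure.pi fun _ => T) + 1 / m := by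
  have hm' : (0 : ℝ) < m := by positivity
  set P : Measure (Fin m → Z) := Measure.pi fun _ => T with hP
  obtain ⟨μ, hμ⟩ : ∃ μ, μ = ∫ z, φ z ∂T := ⟨_, rfl⟩
  rw [← hμ]
  have hμ0 : 0 ≤ μ := hμ ▸ integral_nonneg fun z => (hφ z).1
  rcases hμ0.eq_or_lt with h0 | hpos
  · rw [← h0, Real.negMulLog_zero]
    have : 0 ≤ ∫ D : Fin m → Z, Real.negMulLog (empiricalMean φ D) ∂P :=
      integral_nonneg fun D => Real.negMulLog_nonneg (empiricalMean_mem_Icc hφ D).1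
        (empiricalMean_mem_Icc hφ D).2
    positivity
  have hmeas : Measurable fun D : Fin m → Z => empiricalMean φ D := measurable_empiricalMean hφm
  have hint : Integrable (fun D : Fin m → Z => empiricalMean φ D) P :=
    integrable_of_mem_Icc hmeas (empiricalMean_mem_Icc hφ)
  have hint2 : Integrable (fun D : Fin m → Z => empiricalMean φ D ^ 2) P :=
    integrable_of_mem_Icc (hmeas.pow_const 2) fun D =>
      ⟨sq_nonneg _, pow_le_one₀ (empiricalMean_mem_Icc hφ D).1 (empiricalMean_mem_Icc hφ D).2⟩
  have hE : ∫ D : Fin m → Z, empiricalMean φ D ∂P = μ := by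
    rw [hμ]; exact integral_empiricalMean hm hφm hφ
  have hpt : ∀ D : Fin m → Z, (1 - Real.log μ) * empiricalMean φ D - empiricalMean φ D ^ 2 / μ ≤
      Real.negMulLog (empiricalMean φ D) := by
    intro D
    rcases (empiricalMean_mem_Icc hφ D).1.eq_or_lt with hu | hu
    · rw [← hu]; simp
    · have h := Real.log_le_sub_one_of_pos (div_pos hu hpos)
      rw [Real.log_div hu.ne' hpos.ne'] at h
      have h2 := mul_le_mul_of_nonneg_left h hu.le
      simp only [Real.negMulLog]
      have h3 : empiricalMean φ D * (empiricalMean φ D / μ - 1)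
          = empiricalMean φ D ^ 2 / μ - empiricalMean φ D := by ring
      linarith
  have hle := integral_mono ((hint.const_mul (1 - Real.log μ)).sub (hint2.div_const μ))
    (integrable_negMulLog_empiricalMean hφm hφ) hpt
  rw [integral_sub' (hint.const_mul _) (hint2.div_const μ), integral_const_mul, hE,
    integral_div] at hle
  have hLp : MemLp (fun D : Fin m → Z => empiricalMean φ D) 2 P :=
    memLp_of_bounded (ae_of_all _ (empiricalMean_mem_Icc hφ)) hmeas.aestronglyMeasurable 2
  have hvar := variance_empiricalMean_le (T := T) hm hφm hφ
  rw [← hP, variance_eq_sub hLp, hE, ← hμ] at hvar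
  have hsq : (∫ D : Fin m → Z, empiricalMean φ D ^ 2 ∂P) / μ ≤ μ + 1 / m := by
    rw [div_le_iff₀ hpos]
    have : (μ + 1 / m) * μ = μ ^ 2 + μ / m := by ring
    rw [this]
    have h' : ∫ D : Fin m → Z, empiricalMean φ D ^ 2 ∂P =
      P[(fun D : Fin m → Z => empiricalMean φ D) ^ 2] := rfl
    linarith
  simp only [Real.negMulLog] at hle ⊢
  linarith

/-- The plug-in estimate of a mutual information overestimates by at most `|A| |B| / m` on average:
the marginal entropies are underestimated, by concavity, and each of the `|A| |B|` terms of the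
joint entropy is underestimated by at most `1 / m`. -/
lemma integral_mutualInfo_empiricalMean_le {A B : Type*} [Fintype A] [Fintype B]
    (hm : 1 ≤ m) {φ : A → B → Z → ℝ} (hφm : ∀ a b, Measurable (φ a b)) (hφ : ∀ a b z, 0 ≤ φ a b z)
    (hsum : ∀ z, ∑ a, ∑ b, φ a b z = 1) :
    ∫ D : Fin m → Z, mutualInfo (fun a b => empiricalMean (φ a b) D) ∂(Measure.pi fun _ => T) ≤
      mutualInfo (fun a b => ∫ z, φ a b z ∂T) + Fintype.card A * Fintype.card B / m := by
  have hsum' : ∀ z, ∑ b, ∑ a, φ a b z = 1 := fun z => by rw [Finset.sum_comm]; exact hsum z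
  have hA0 : ∀ a z, 0 ≤ ∑ b, φ a b z := fun a z => Finset.sum_nonneg fun b _ => hφ a b z
  have hB0 : ∀ b z, 0 ≤ ∑ a, φ a b z := fun b z => Finset.sum_nonneg fun a _ => hφ a b z
  have hA : ∀ a z, ∑ b, φ a b z ∈ Set.Icc (0 : ℝ) 1 := fun a z =>
    mem_Icc_of_sum_eq_one (fun a => hA0 a z) (hsum z) a
  have hB : ∀ b z, ∑ a, φ a b z ∈ Set.Icc (0 : ℝ) 1 := fun b z =>
    mem_Icc_of_sum_eq_one (fun b => hB0 b z) (hsum' z) b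
  have hAB : ∀ a b z, φ a b z ∈ Set.Icc (0 : ℝ) 1 := fun a b z =>
    ⟨hφ a b z, (Finset.single_le_sum (f := fun b => φ a b z) (fun b _ => hφ a b z)
      (Finset.mem_univ b)).trans (hA a z).2⟩
  have hAm : ∀ a, Measurable fun z => ∑ b, φ a b z :=
    fun a => Finset.measurable_sum _ fun b _ => hφm a b
  have hBm : ∀ b, Measurable fun z => ∑ a, φ a b z :=
    fun b => Finset.measurable_sum _ fun a _ => hφm a b
  have hi : ∀ a b, Integrable (φ a b) T := fun a b => integrable_of_mem_Icc (hφm a b) (hAB a b)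
  rw [mutualInfo_eq_add_sub fun a b => integral_nonneg (hφ a b)]
  simp_rw [fun D : Fin m → Z => mutualInfo_eq_add_sub (q := fun a b => empiricalMean (φ a b) D)
    fun a b => (empiricalMean_mem_Icc (hAB a b) D).1, sum_empiricalMean,
    fun a => (integral_finsetSum Finset.univ fun b _ => hi a b).symm,
    fun b => (integral_finsetSum Finset.univ fun a _ => hi a b).symm]
  have iA := fun a => integrable_negMulLog_empiricalMean (T := T) (m := m) (hAm a) (hA a)
  have iB := fun b => integrable_negMulLog_empiricalMean (T := T) (m := m) (hBm b) (hB b)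
  have iAB := fun a b => integrable_negMulLog_empiricalMean (T := T) (m := m) (hφm a b) (hAB a b)
  rw [integral_sub, integral_add, integral_finsetSum _ fun a _ => iA a,
    integral_finsetSum _ fun b _ => iB b, integral_finsetSum]
  · simp_rw [fun a => integral_finsetSum Finset.univ fun b _ => iAB a b]
    have h1 := Finset.sum_le_sum fun a (_ : a ∈ Finset.univ) =>
      integral_negMulLog_empiricalMean_le (T := T) hm (hAm a) (hA a)
    have h2 := Finset.sum_le_sum fun b (_ : b ∈ Finset.univ) =>
      integral_negMulLog_empiricalMean_le (T := T) hm (hBm b) (hB b)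
    have h3 := Finset.sum_le_sum fun a (_ : a ∈ Finset.univ) =>
      Finset.sum_le_sum fun b (_ : b ∈ Finset.univ) =>
        negMulLog_integral_le (T := T) hm (hφm a b) (hAB a b)
    simp only [Finset.sum_add_distrib, Finset.sum_const, Finset.card_univ, nsmul_eq_mul] at h3
    have h4 : (Fintype.card A : ℝ) * (Fintype.card B * (1 / m)) =
      Fintype.card A * Fintype.card B / m := by ring
    rw [h4] at h3
    linarith
  · exact fun a _ => integrable_finsetSum _ fun b _ => iAB a b
  · exact integrable_finsetSum _ fun a _ => iA a
  · exact integrable_finsetSum _ fun b _ => iB b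
  · exact (integrable_finsetSum _ fun a _ => iA a).add (integrable_finsetSum _ fun b _ => iB b)
  · exact integrable_finsetSum _ fun a _ => integrable_finsetSum _ fun b _ => iAB a b

end EmpiricalMean

/-! ### Symmetrization -/

lemma sum_exp_sign_le {n : ℕ} (x : Fin n → ℝ) {c : ℝ} (hx : ∀ k, |x k| ≤ c) (l : ℝ) :
    ∑ σ : Fin n → Bool, Real.exp (l * ∑ k, if σ k then -x k else x k) ≤
      2 ^ n * Real.exp (n * (l ^ 2 * c ^ 2 / 2)) := by
  have h1 : ∀ σ : Fin n → Bool, Real.exp (l * ∑ k, if σ k then -x k else x k) =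
      ∏ k, Real.exp (l * if σ k then -x k else x k) := by
    intro σ
    rw [Finset.mul_sum, Real.exp_sum]
  have h2 := Finset.prod_univ_sum (fun _ : Fin n => (Finset.univ : Finset Bool))
    (fun k s => Real.exp (l * if s then -x k else x k))
  rw [Fintype.piFinset_univ] at h2
  simp_rw [h1]
  rw [← h2]
  have h3 : ∀ k, ∑ s : Bool, Real.exp (l * if s then -x k else x k) ≤
      2 * Real.exp (l ^ 2 * c ^ 2 / 2) := by
    intro k
    have hcosh := Real.cosh_le_exp_half_sq (l * x k)
    have hsq : x k ^ 2 ≤ c ^ 2 := sq_le_sq' (abs_le.mp (hx k)).1 (abs_le.mp (hx k)).2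
    have hle : (l * x k) ^ 2 / 2 ≤ l ^ 2 * c ^ 2 / 2 := by
      rw [mul_pow]; gcongr
    rw [Real.cosh_eq] at hcosh
    have := Real.exp_le_exp.mpr hle
    simp only [Fintype.sum_bool, if_true, Bool.false_eq_true, if_false, mul_neg]
    linarith
  calc _ ≤ ∏ _k : Fin n, 2 * Real.exp (l ^ 2 * c ^ 2 / 2) :=
        Finset.prod_le_prod (fun k _ => Finset.sum_nonneg fun s _ => (Real.exp_pos _).le)
          fun k _ => h3 k
    _ = _ := by
        rw [Finset.prod_const, Finset.card_univ, Fintype.card_fin, mul_pow, ← Real.exp_nat_mul]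

section Deviation

variable {ι Z : Type*} [MeasurableSpace Z] {n : ℕ}

/-- Exchange the points `(w k).1` and `(w k).2` of the two samples at the positions selected by
`σ`. -/
def exchange (σ : Fin n → Bool) (w : Fin n → Z × Z) : Fin n → Z × Z :=
  fun k => if σ k then (w k).swap else w k

lemma measurePreserving_exchange (μ : Measure Z) [IsProbabilityMeasure μ] (σ : Fin n → Bool) :
    MeasurePreserving (exchange (Z := Z) σ) (Measure.pi fun _ => μ.prod μ)
      (Measure.pi fun _ => μ.prod μ) := by
  refine measurePreserving_pi (fun _ => μ.prod μ) (fun _ => μ.prod μ)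
    (f := fun k z => if σ k then z.swap else z) fun k => ?_
  by_cases h : σ k
  · simp only [h, if_true]
    exact Measure.measurePreserving_swap
  · simp only [h]
    exact MeasurePreserving.id _

/-- The maximal exponential moment of the differences between the two samples in `w`. -/
def maxExp (F : Finset ι) (hF : F.Nonempty) (g : ι → Z → ℝ) (l : ℝ) (w : Fin n → Z × Z) : ℝ :=
  F.sup' hF fun i => Real.exp (l * ∑ k, (g i (w k).1 - g i (w k).2))

variable {F : Finset ι} {hF : F.Nonempty} {g : ι → Z → ℝ} {l c η : ℝ}

lemma measurable_maxExp (hg : ∀ i, Measurable (g i)) :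
    Measurable (maxExp (n := n) F hF g l) := by
  have : maxExp (n := n) F hF g l =
      F.sup' hF fun i w => Real.exp (l * ∑ k, (g i (w k).1 - g i (w k).2)) := by
    ext w
    rw [maxExp, Finset.sup'_apply]
  rw [this]
  refine Finset.measurable_sup' hF fun i _ => ?_
  have := hg i
  fun_prop

omit [MeasurableSpace Z] in
lemma maxExp_mem_Icc (hl : 0 ≤ l) (hgc : ∀ i z, |g i z| ≤ c) (w : Fin n → Z × Z) :
    maxExp F hF g l w ∈ Set.Icc 0 (Real.exp (l * (n * (2 * c)))) := by
  constructor
  · obtain ⟨i, hi⟩ := hF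
    exact (Real.exp_pos _).le.trans
      (Finset.le_sup' (fun i => Real.exp (l * ∑ k, (g i (w k).1 - g i (w k).2))) hi)
  · refine Finset.sup'_le _ _ fun i _ => ?_
    gcongr
    calc ∑ k, (g i (w k).1 - g i (w k).2) ≤ ∑ _k : Fin n, 2 * c := by
          refine Finset.sum_le_sum fun k _ => ?_
          linarith [(abs_le.mp (hgc i (w k).1)).2, (abs_le.mp (hgc i (w k).2)).1]
      _ = n * (2 * c) := by simp

omit [MeasurableSpace Z] in
/-- Averaging over the random signs, with a finite net in place of the class. -/
lemma sum_maxExp_exchange_le (hl : 0 ≤ l) (hgc : ∀ i z, |g i z| ≤ c) (w : Fin n → Z × Z)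
    (V : Finset ι) (hV : ∀ i ∈ F, ∃ j ∈ V,
      ∑ k, |(g i (w k).1 - g i (w k).2) - (g j (w k).1 - g j (w k).2)| ≤ n * η) :
    ∑ σ : Fin n → Bool, maxExp F hF g l (exchange σ w) ≤
      2 ^ n * (V.card * Real.exp (l * (n * η) + n * (l ^ 2 * (2 * c) ^ 2 / 2))) := by
  have hdiff : ∀ (σ : Fin n → Bool) (i : ι) (k : Fin n),
      g i (exchange σ w k).1 - g i (exchange σ w k).2 =
        if σ k then -(g i (w k).1 - g i (w k).2) else g i (w k).1 - g i (w k).2 := by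
    intro σ i k
    by_cases h : σ k <;> simp [exchange, h]
  have hmax : ∀ σ : Fin n → Bool, maxExp F hF g l (exchange σ w) ≤
      ∑ j ∈ V, Real.exp (l * (n * η)) *
        Real.exp (l * ∑ k, if σ k then -(g j (w k).1 - g j (w k).2)
          else g j (w k).1 - g j (w k).2) := by
    intro σ
    refine Finset.sup'_le _ _ fun i hi => ?_
    obtain ⟨j, hj, hij⟩ := hV i hi
    refine le_trans ?_ (Finset.single_le_sum (fun j _ => by positivity) hj)
    rw [← Real.exp_add, ← mul_add]
    gcongr
    refine le_trans ?_ (add_le_add_left hij _)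
    rw [← Finset.sum_add_distrib]
    refine Finset.sum_le_sum fun k _ => ?_
    rw [hdiff]
    have h1 := le_abs_self ((g i (w k).1 - g i (w k).2) - (g j (w k).1 - g j (w k).2))
    have h2 := neg_abs_le ((g i (w k).1 - g i (w k).2) - (g j (w k).1 - g j (w k).2))
    split_ifs <;> linarith
  calc _ ≤ ∑ σ : Fin n → Bool, ∑ j ∈ V, Real.exp (l * (n * η)) *
        Real.exp (l * ∑ k, if σ k then -(g j (w k).1 - g j (w k).2)
          else g j (w k).1 - g j (w k).2) := Finset.sum_le_sum fun σ _ => hmax σ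
    _ = ∑ j ∈ V, Real.exp (l * (n * η)) * ∑ σ : Fin n → Bool,
        Real.exp (l * ∑ k, if σ k then -(g j (w k).1 - g j (w k).2)
          else g j (w k).1 - g j (w k).2) := by
        rw [Finset.sum_comm]
        simp_rw [Finset.mul_sum]
    _ ≤ ∑ _j ∈ V, Real.exp (l * (n * η)) *
          (2 ^ n * Real.exp (n * (l ^ 2 * (2 * c) ^ 2 / 2))) := by
        gcongr with j _
        refine sum_exp_sign_le _ (fun k => ?_) l
        rw [abs_le]
        constructor <;> linarith [abs_le.mp (hgc j (w k).1), abs_le.mp (hgc j (w k).2)]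
    _ = _ := by
        rw [Finset.sum_const, nsmul_eq_mul, Real.exp_add]
        ring

variable {μ : Measure Z} [IsProbabilityMeasure μ]

lemma integrable_maxExp (hl : 0 ≤ l) (hg : ∀ i, Measurable (g i)) (hgc : ∀ i z, |g i z| ≤ c) :
    Integrable (maxExp (n := n) F hF g l) (Measure.pi fun _ => μ.prod μ) :=
  Integrable.of_mem_Icc _ _ (measurable_maxExp hg).aemeasurable
    (ae_of_all _ (maxExp_mem_Icc hl hgc))

lemma integral_maxExp_le {N : ℝ} (hl : 0 ≤ l) (hg : ∀ i, Measurable (g i))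
    (hgc : ∀ i z, |g i z| ≤ c)
    (hnet : ∀ w : Fin n → Z × Z, ∃ V : Finset ι, (V.card : ℝ) ≤ N ∧ ∀ i ∈ F, ∃ j ∈ V,
      ∑ k, |(g i (w k).1 - g i (w k).2) - (g j (w k).1 - g j (w k).2)| ≤ n * η) :
    ∫ w : Fin n → Z × Z, maxExp F hF g l w ∂(Measure.pi fun _ => μ.prod μ) ≤
      N * Real.exp (l * (n * η) + n * (l ^ 2 * (2 * c) ^ 2 / 2)) := by
  set Q : Measure (Fin n → Z × Z) := Measure.pi fun _ => μ.prod μ with hQ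
  have hex := fun σ => measurePreserving_exchange (n := n) μ σ
  have hswap : ∀ σ : Fin n → Bool,
      ∫ w, maxExp F hF g l (exchange σ w) ∂Q = ∫ w, maxExp F hF g l w ∂Q := by
    intro σ
    conv_rhs => rw [hQ, ← (hex σ).map_eq]
    rw [integral_map (hex σ).measurable.aemeasurable
      (measurable_maxExp hg).aestronglyMeasurable]
  have hsum : 2 ^ n * ∫ w, maxExp F hF g l w ∂Q =
      ∫ w, ∑ σ : Fin n → Bool, maxExp F hF g l (exchange σ w) ∂Q := by
    rw [integral_finsetSum (f := fun σ w => maxExp F hF g l (exchange σ w)) _ fun σ _ =>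
      (hex σ).integrable_comp_of_integrable (integrable_maxExp hl hg hgc)]
    rw [← hQ, Finset.sum_congr rfl fun σ _ => hswap σ]
    simp
  have hle : ∫ w, ∑ σ : Fin n → Bool, maxExp F hF g l (exchange σ w) ∂Q ≤
      ∫ _w : Fin n → Z × Z,
        2 ^ n * (N * Real.exp (l * (n * η) + n * (l ^ 2 * (2 * c) ^ 2 / 2))) ∂Q := by
    refine integral_mono (integrable_finsetSum _ fun σ _ =>
      (hex σ).integrable_comp_of_integrable (integrable_maxExp hl hg hgc))
      (integrable_const _) fun w => ?_
    obtain ⟨V, hVN, hV⟩ := hnet w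
    refine (sum_maxExp_exchange_le hl hgc w V hV).trans ?_
    gcongr
  rw [← hsum, integral_const, probReal_univ, one_smul] at hle
  exact le_of_mul_le_mul_left hle (by positivity)

/-- Symmetrization by an independent second sample: Jensen's inequality moves the expectation over
the second sample out of the exponential and out of the maximum. -/
lemma exp_le_integral_maxExp (hl : 0 ≤ l) (hg : ∀ i, Measurable (g i))
    (hgc : ∀ i z, |g i z| ≤ c) (D : Fin n → Z) {i : ι} (hi : i ∈ F) :
    Real.exp (l * ∑ k, (g i (D k) - ∫ z, g i z ∂μ)) ≤
      ∫ D' : Fin n → Z, maxExp F hF g l (fun k => (D k, D' k)) ∂(Measure.pi fun _ => μ) := by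
  set P : Measure (Fin n → Z) := Measure.pi fun _ => μ with hP
  have hgi : Integrable (g i) μ :=
    Integrable.of_mem_Icc (-c) c (hg i).aemeasurable (ae_of_all _ fun z => abs_le.mp (hgc i z))
  have hk : ∀ k : Fin n, MeasurePreserving (fun D : Fin n → Z => D k) P μ :=
    fun k => measurePreserving_eval (fun _ => μ) k
  have hgk : ∀ k : Fin n, Integrable (fun D' : Fin n → Z => g i (D' k)) P :=
    fun k => (hk k).integrable_comp_of_integrable hgi
  have hEk : ∀ k : Fin n, ∫ D' : Fin n → Z, g i (D' k) ∂P = ∫ z, g i z ∂μ := by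
    intro k
    rw [← (hk k).map_eq, integral_map (hk k).measurable.aemeasurable
      (hg i).aestronglyMeasurable]
  set X : (Fin n → Z) → ℝ := fun D' => l * ∑ k, (g i (D k) - g i (D' k)) with hX
  have hXint : Integrable X P :=
    (integrable_finsetSum _ fun k _ => (integrable_const _).sub (hgk k)).const_mul l
  have hXE : ∫ D', X D' ∂P = l * ∑ k, (g i (D k) - ∫ z, g i z ∂μ) := by
    rw [hX, integral_const_mul, integral_finsetSum (f := fun k (D' : Fin n → Z) =>
      g i (D k) - g i (D' k)) _ fun k _ => (integrable_const _).sub (hgk k)]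
    congr 1
    refine Finset.sum_congr rfl fun k _ => ?_
    rw [integral_sub (integrable_const _) (hgk k), hEk]
    simp
  have hpair : Measurable fun D' : Fin n → Z => fun k => (D k, D' k) := by fun_prop
  have hle : ∀ D', Real.exp (X D') ≤ maxExp F hF g l (fun k => (D k, D' k)) := fun D' =>
    Finset.le_sup' (fun i => Real.exp (l * ∑ k, (g i (D k) - g i (D' k)))) hi
  have hexpint : Integrable (fun D' => Real.exp (X D')) P := by
    refine Integrable.of_mem_Icc 0 (Real.exp (l * (n * (2 * c)))) ?_ (ae_of_all _ fun D' =>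
      ⟨(Real.exp_pos _).le, (hle D').trans (maxExp_mem_Icc hl hgc _).2⟩)
    exact (Real.measurable_exp.comp_aemeasurable hXint.aemeasurable)
  rw [← hXE]
  refine (convexOn_exp.map_integral_le Real.continuous_exp.continuousOn isClosed_univ
    (ae_of_all _ fun _ => Set.mem_univ _) hXint hexpint).trans ?_
  refine integral_mono hexpint ?_ hle
  exact Integrable.of_mem_Icc _ _ ((measurable_maxExp hg).comp hpair).aemeasurable
    (ae_of_all _ fun D' => maxExp_mem_Icc hl hgc _)

/-- Uniform deviation bound for a finite class all of whose empirical nets are small. -/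
lemma measure_exists_deviation_le {N : ℝ} (hl : 0 ≤ l) (hg : ∀ i, Measurable (g i))
    (hgc : ∀ i z, |g i z| ≤ c)
    (hnet : ∀ w : Fin n → Z × Z, ∃ V : Finset ι, (V.card : ℝ) ≤ N ∧ ∀ i ∈ F, ∃ j ∈ V,
      ∑ k, |(g i (w k).1 - g i (w k).2) - (g j (w k).1 - g j (w k).2)| ≤ n * η) (t : ℝ) :
    (Measure.pi fun _ => μ) {D : Fin n → Z | ∃ i ∈ F, t < ∑ k, (g i (D k) - ∫ z, g i z ∂μ)} ≤
      ENNReal.ofReal (N * Real.exp (l * (n * η) + n * (l ^ 2 * (2 * c) ^ 2 / 2) - l * t)) := by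
  rcases F.eq_empty_or_nonempty with rfl | hF
  · simp
  set P : Measure (Fin n → Z) := Measure.pi fun _ => μ with hP
  set J : (Fin n → Z) → ℝ := fun D =>
    ∫ D' : Fin n → Z, maxExp F hF g l (fun k => (D k, D' k)) ∂P with hJ
  have hmp := measurePreserving_arrowProdEquivProdArrow Z Z (Fin n) (fun _ => μ) (fun _ => μ)
  have hpair : Measurable fun p : (Fin n → Z) × (Fin n → Z) => fun k => (p.1 k, p.2 k) := by
    fun_prop
  have hmeas : Measurable fun p : (Fin n → Z) × (Fin n → Z) =>
      maxExp F hF g l (fun k => (p.1 k, p.2 k)) := (measurable_maxExp hg).comp hpair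
  have hint : Integrable (fun p : (Fin n → Z) × (Fin n → Z) =>
      maxExp F hF g l (fun k => (p.1 k, p.2 k))) (P.prod P) :=
    Integrable.of_mem_Icc _ _ hmeas.aemeasurable (ae_of_all _ fun p => maxExp_mem_Icc hl hgc _)
  have hJE : ∫ D, J D ∂P ≤ N * Real.exp (l * (n * η) + n * (l ^ 2 * (2 * c) ^ 2 / 2)) := by
    rw [hJ, ← integral_prod _ hint, hP, ← hmp.map_eq, integral_map hmp.measurable.aemeasurable
      hmeas.aestronglyMeasurable]
    exact integral_maxExp_le hl hg hgc hnet
  have hsub : {D : Fin n → Z | ∃ i ∈ F, t < ∑ k, (g i (D k) - ∫ z, g i z ∂μ)} ⊆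
      {D | Real.exp (l * t) ≤ J D} := by
    rintro D ⟨i, hi, ht⟩
    refine le_trans ?_ (exp_le_integral_maxExp hl hg hgc D hi)
    gcongr
  have hmarkov := mul_meas_ge_le_integral_of_nonneg (μ := P) (f := J)
    (ae_of_all _ fun D => integral_nonneg fun D' => (maxExp_mem_Icc hl hgc _).1)
    hint.integral_prod_left (Real.exp (l * t))
  refine (measure_mono hsub).trans ?_
  rw [← ofReal_measureReal]
  refine ENNReal.ofReal_le_ofReal ?_
  rw [Real.exp_sub, ← mul_div_assoc, le_div_iff₀ (Real.exp_pos _), mul_comm]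
  exact hmarkov.trans hJE

end Deviation

/-! ### Code-label distributions of an encoder -/

section Encoder

set_option linter.unusedSectionVars false

variable {X C Y : Type*} [MeasurableSpace X] [Fintype C] [MeasurableSpace C]
  [MeasurableSingletonClass C] [Fintype Y] [MeasurableSpace Y] [MeasurableSingletonClass Y]

open Classical in
/-- The contribution `κ (c | x) 1{label = y}` of a sample `z = (x, label)` to the joint
distribution of codes and labels. -/
def codeLabelWeight (κ : Kernel X C) (c : C) (y : Y) (z : X × Y) : ℝ :=
  if z.2 = y then (κ z.1).real {c} else 0

lemma empiricalPMF_eq {m : ℕ} (κ : Kernel X C) (D : Fin m → X × Y) :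
    empiricalPMF κ D = fun c y => empiricalMean (codeLabelWeight κ c y) D := rfl

lemma jointPMF_eq (κ : Kernel X C) (T : Measure (X × Y)) :
    jointPMF κ T = fun c y => ∫ z, codeLabelWeight κ c y z ∂T := by
  funext c y
  have hs : MeasurableSet {z : X × Y | z.2 = y} := measurable_snd (measurableSet_singleton y)
  rw [jointPMF, ← integral_indicator hs]
  rfl

lemma codeLabelWeight_nonneg (κ : Kernel X C) (c : C) (y : Y) (z : X × Y) :
    0 ≤ codeLabelWeight κ c y z := by
  unfold codeLabelWeight
  split_ifs <;> positivity

lemma sum_codeLabelWeight_labels (κ : Kernel X C) (c : C) (z : X × Y) :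
    ∑ y, codeLabelWeight κ c y z = (κ z.1).real {c} := by
  rw [Finset.sum_eq_single z.2]
  · simp [codeLabelWeight]
  · intro y _ hy
    simp [codeLabelWeight, hy.symm]
  · simp

open Classical in
lemma sum_codeLabelWeight_codes (κ : Kernel X C) [IsMarkovKernel κ] (y : Y) (z : X × Y) :
    ∑ c, codeLabelWeight κ c y z = if z.2 = y then 1 else 0 := by
  unfold codeLabelWeight
  split_ifs
  · rw [sum_measureReal_singleton]; simp
  · simp

lemma sum_codeLabelWeight (κ : Kernel X C) [IsMarkovKernel κ] (z : X × Y) :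
    ∑ c, ∑ y, codeLabelWeight κ c y z = 1 := by
  simp only [sum_codeLabelWeight_labels]
  rw [sum_measureReal_singleton]
  simp

lemma measurable_kernel_singleton (κ : Kernel X C) (c : C) : Measurable fun x => (κ x).real {c} :=
  (Kernel.measurable_coe κ (measurableSet_singleton c)).ennreal_toReal

lemma measurable_codeLabelWeight (κ : Kernel X C) (c : C) (y : Y) :
    Measurable (codeLabelWeight κ c y) :=
  Measurable.ite (measurable_snd (measurableSet_singleton y))
    ((measurable_kernel_singleton κ c).comp measurable_fst) measurable_const

lemma codeLabelWeight_mem_Icc (κ : Kernel X C) [IsMarkovKernel κ] (c : C) (y : Y) (z : X × Y) :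
    codeLabelWeight κ c y z ∈ Set.Icc (0 : ℝ) 1 := by
  refine ⟨codeLabelWeight_nonneg κ c y z, ?_⟩
  unfold codeLabelWeight
  split_ifs
  · exact measureReal_le_one
  · exact zero_le_one

lemma empiricalPMF_nonneg {m : ℕ} (κ : Kernel X C) [IsMarkovKernel κ] (D : Fin m → X × Y) (c : C)
    (y : Y) : 0 ≤ empiricalPMF κ D c y := by
  rw [empiricalPMF_eq]
  exact (empiricalMean_mem_Icc (codeLabelWeight_mem_Icc κ c y) D).1

lemma jointPMF_nonneg (κ : Kernel X C) (T : Measure (X × Y)) (c : C) (y : Y) :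
    0 ≤ jointPMF κ T c y := by
  rw [jointPMF_eq]
  exact integral_nonneg (codeLabelWeight_nonneg κ c y)

lemma sum_empiricalPMF {m : ℕ} (hm : 1 ≤ m) (κ : Kernel X C) [IsMarkovKernel κ]
    (D : Fin m → X × Y) : ∑ c, ∑ y, empiricalPMF κ D c y = 1 := by
  have hm' : (m : ℝ) ≠ 0 := by positivity
  simp only [empiricalPMF_eq, sum_empiricalMean, sum_codeLabelWeight]
  simp [empiricalMean, hm']

lemma sum_jointPMF (κ : Kernel X C) [IsMarkovKernel κ] (T : Measure (X × Y))
    [IsProbabilityMeasure T] : ∑ c, ∑ y, jointPMF κ T c y = 1 := by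
  have hi : ∀ c y, Integrable (codeLabelWeight (Y := Y) κ c y) T := fun c y =>
    integrable_of_mem_Icc (measurable_codeLabelWeight κ c y) (codeLabelWeight_mem_Icc κ c y)
  simp only [jointPMF_eq]
  simp_rw [fun c => (integral_finsetSum Finset.univ fun y _ => hi c y).symm]
  rw [← integral_finsetSum _ fun c _ => integrable_finsetSum _ fun y _ => hi c y]
  simp [sum_codeLabelWeight]

/-- The label marginal does not depend on the encoder. -/
lemma sum_empiricalPMF_codes {m : ℕ} (κ κ' : Kernel X C) [IsMarkovKernel κ] [IsMarkovKernel κ']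
    (D : Fin m → X × Y) (y : Y) : ∑ c, empiricalPMF κ D c y = ∑ c, empiricalPMF κ' D c y := by
  simp only [empiricalPMF_eq, sum_empiricalMean, sum_codeLabelWeight_codes]

lemma sum_abs_empiricalPMF_sub_le {m : ℕ} (κ κ' : Kernel X C)
    (D : Fin m → X × Y) :
    ∑ c, ∑ y, |empiricalPMF κ D c y - empiricalPMF κ' D c y| ≤
      (1 / (m : ℝ)) * ∑ j, ∑ c, |(κ (D j).1).real {c} - (κ' (D j).1).real {c}| := by
  have h : ∀ c y, |empiricalPMF κ D c y - empiricalPMF κ' D c y| ≤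
      (1 / (m : ℝ)) * ∑ j, |codeLabelWeight κ c y (D j) - codeLabelWeight κ' c y (D j)| := by
    intro c y
    rw [empiricalPMF_eq, empiricalPMF_eq]
    simp only [empiricalMean]
    rw [← mul_sub, ← Finset.sum_sub_distrib, abs_mul, abs_of_nonneg (by positivity)]
    gcongr
    exact Finset.abs_sum_le_sum_abs _ _
  have h2 : ∀ c j, ∑ y, |codeLabelWeight κ c y (D j) - codeLabelWeight κ' c y (D j)| =
      |(κ (D j).1).real {c} - (κ' (D j).1).real {c}| := by
    intro c j
    rw [Finset.sum_eq_single (D j).2]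
    · simp [codeLabelWeight]
    · intro y _ hy
      simp [codeLabelWeight, hy.symm]
    · simp
  refine (Finset.sum_le_sum fun c _ => Finset.sum_le_sum fun y _ => h c y).trans (le_of_eq ?_)
  simp_rw [← Finset.mul_sum]
  congr 1
  rw [Finset.sum_comm (f := fun j c => |(κ (D j).1).real {c} - (κ' (D j).1).real {c}|)]
  refine Finset.sum_congr rfl fun c _ => ?_
  rw [Finset.sum_comm]
  exact Finset.sum_congr rfl fun j _ => h2 c j

lemma measurable_mutualInfo_empiricalPMF {m : ℕ} (κ : Kernel X C) :
    Measurable fun D : Fin m → X × Y => mutualInfo (empiricalPMF κ D) := by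
  exact measurable_mutualInfo (q := fun D c y => empiricalMean (codeLabelWeight κ c y) D)
    fun c y => measurable_empiricalMean (measurable_codeLabelWeight κ c y)

lemma measurable_mutualInfo_jointPMF (κ : Kernel X C) :
    Measurable fun T : ProbabilityMeasure (X × Y) =>
      mutualInfo (jointPMF κ (T : Measure (X × Y))) := by
  refine measurable_mutualInfo fun c y => ?_
  simp only [jointPMF_eq]
  have hm := measurable_codeLabelWeight κ c y
  have : (fun T : ProbabilityMeasure (X × Y) =>
      ∫ z, codeLabelWeight κ c y z ∂(T : Measure (X × Y))) =
      fun T : ProbabilityMeasure (X × Y) =>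
        (∫⁻ z, ENNReal.ofReal (codeLabelWeight κ c y z) ∂(T : Measure (X × Y))).toReal := by
    funext T
    exact integral_eq_lintegral_of_nonneg_ae (ae_of_all _ (codeLabelWeight_nonneg κ c y))
      hm.aestronglyMeasurable
  rw [this]
  exact ((Measure.measurable_lintegral hm.ennreal_ofReal).comp
    measurable_subtype_coe).ennreal_toReal

lemma abs_mutualInfo_empiricalPMF_le {m : ℕ} (hm : 1 ≤ m) (κ : Kernel X C) [IsMarkovKernel κ]
    (D : Fin m → X × Y) : |mutualInfo (empiricalPMF κ D)| ≤ Real.log (Fintype.card C) :=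
  abs_mutualInfo_le (empiricalPMF_nonneg κ D) (sum_empiricalPMF hm κ D)

lemma abs_mutualInfo_jointPMF_le (κ : Kernel X C) [IsMarkovKernel κ] (T : Measure (X × Y))
    [IsProbabilityMeasure T] : |mutualInfo (jointPMF κ T)| ≤ Real.log (Fintype.card C) :=
  abs_mutualInfo_le (jointPMF_nonneg κ T) (sum_jointPMF κ T)

instance (Z : Type*) [MeasurableSpace Z] (m : ℕ) : IsMarkovKernel (sampleKernel Z m) :=
  ⟨fun T => inferInstanceAs (IsProbabilityMeasure (Measure.pi fun _ : Fin m => (T : Measure Z)))⟩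

lemma integral_mutualInfo_empiricalPMF_le {m : ℕ} (hm : 1 ≤ m) (κ : Kernel X C) [IsMarkovKernel κ]
    (τ : Measure (ProbabilityMeasure (X × Y))) [IsProbabilityMeasure τ] :
    ∫ D : Fin m → X × Y, mutualInfo (empiricalPMF κ D) ∂(sampleKernel (X × Y) m ∘ₘ τ) ≤
      -expectedLoss τ κ + Fintype.card C * Fintype.card Y / m := by
  have hint : Integrable (fun D : Fin m → X × Y => mutualInfo (empiricalPMF κ D))
      (sampleKernel (X × Y) m ∘ₘ τ) :=
    Integrable.of_mem_Icc _ _ (measurable_mutualInfo_empiricalPMF κ).aemeasurable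
      (ae_of_all _ fun D => abs_le.mp (abs_mutualInfo_empiricalPMF_le hm κ D))
  have hint' : Integrable (fun T : ProbabilityMeasure (X × Y) =>
      mutualInfo (jointPMF κ (T : Measure (X × Y)))) τ :=
    Integrable.of_mem_Icc _ _ (measurable_mutualInfo_jointPMF κ).aemeasurable
      (ae_of_all _ fun T => abs_le.mp (abs_mutualInfo_jointPMF_le κ (T : Measure (X × Y))))
  rw [Measure.comp_eq_comp_const_apply] at hint ⊢
  rw [Kernel.integral_comp hint]
  have hint2 := hint.integral_comp
  rw [Kernel.const_apply] at hint2 ⊢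
  refine (integral_mono hint2 (hint'.add (integrable_const
    ((Fintype.card C : ℝ) * Fintype.card Y / m))) fun T => ?_).trans (le_of_eq ?_)
  · have h := integral_mutualInfo_empiricalMean_le (T := (T : Measure (X × Y))) hm
      (φ := fun c y => codeLabelWeight κ c y) (fun c y => measurable_codeLabelWeight κ c y)
      (fun c y z => codeLabelWeight_nonneg κ c y z) (sum_codeLabelWeight κ)
    rw [← jointPMF_eq] at h
    exact h
  · rw [integral_add' hint' (integrable_const _), expectedLoss, neg_neg]
    simp

/-! ### Separability -/

lemma tendsto_jointPMF {κ : ℕ → Kernel X C} {κ₀ : Kernel X C} [∀ k, IsMarkovKernel (κ k)]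
    (h : ∀ x c, Tendsto (fun k => (κ k x).real {c}) atTop (𝓝 ((κ₀ x).real {c})))
    (T : Measure (X × Y)) [IsProbabilityMeasure T] (c : C) (y : Y) :
    Tendsto (fun k => jointPMF (κ k) T c y) atTop (𝓝 (jointPMF κ₀ T c y)) := by
  simp only [jointPMF]
  refine tendsto_integral_of_dominated_convergence (fun _ => 1)
    (fun k => ((measurable_kernel_singleton (κ k) c).comp measurable_fst).aestronglyMeasurable)
    (integrable_const _) (fun k => ae_of_all _ fun z => ?_) (ae_of_all _ fun z => h z.1 c)
  rw [Real.norm_of_nonneg measureReal_nonneg]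
  exact measureReal_le_one

lemma tendsto_expectedLoss {κ : ℕ → Kernel X C} {κ₀ : Kernel X C} [∀ k, IsMarkovKernel (κ k)]
    (h : ∀ x c, Tendsto (fun k => (κ k x).real {c}) atTop (𝓝 ((κ₀ x).real {c})))
    (τ : Measure (ProbabilityMeasure (X × Y))) [IsProbabilityMeasure τ] :
    Tendsto (fun k => expectedLoss τ (κ k)) atTop (𝓝 (expectedLoss τ κ₀)) := by
  refine Tendsto.neg (tendsto_integral_of_dominated_convergence
    (fun _ => Real.log (Fintype.card C))
    (fun k => (measurable_mutualInfo_jointPMF (κ k)).aestronglyMeasurable)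
    (integrable_const _) (fun k => ae_of_all _ fun T => ?_) (ae_of_all _ fun T => ?_))
  · exact abs_mutualInfo_jointPMF_le (κ k) (T : Measure (X × Y))
  · exact tendsto_mutualInfo (fun k => jointPMF_nonneg (κ k) _) (jointPMF_nonneg κ₀ _)
      (tendsto_jointPMF h (T : Measure (X × Y)))

lemma tendsto_empiricalLoss {n m : ℕ} {κ : ℕ → Kernel X C} {κ₀ : Kernel X C}
    [∀ k, IsMarkovKernel (κ k)] [IsMarkovKernel κ₀]
    (h : ∀ x c, Tendsto (fun k => (κ k x).real {c}) atTop (𝓝 ((κ₀ x).real {c})))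
    (D : Fin n → Fin m → X × Y) :
    Tendsto (fun k => empiricalLoss D (κ k)) atTop (𝓝 (empiricalLoss D κ₀)) := by
  refine Tendsto.neg (Tendsto.const_mul _ (tendsto_finsetSum _ fun i _ => ?_))
  refine tendsto_mutualInfo (fun k => empiricalPMF_nonneg (κ k) _) (empiricalPMF_nonneg κ₀ _)
    fun c y => Tendsto.const_mul _ (tendsto_finsetSum _ fun j _ => ?_)
  split_ifs
  · exact h _ c
  · exact tendsto_const_nhds

/-- For a pointwise separable class it suffices to bound, uniformly, the probability that some
member of a finite subclass violates the bound `b`. -/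
lemma measure_exists_le_of_finset {Θ : Type*} {p : Θ → Kernel X C} [∀ θ, IsMarkovKernel (p θ)]
    (hp : PointwiseSeparable p) (τ : Measure (ProbabilityMeasure (X × Y))) [IsProbabilityMeasure τ]
    {n m : ℕ} (P : Measure (Fin n → Fin m → X × Y)) {b : ℝ} {δ : ENNReal}
    (h : ∀ F : Finset Θ, P {D | ∃ θ ∈ F, b < expectedLoss τ (p θ) - empiricalLoss D (p θ)} ≤ δ) :
    P {D | ∃ θ, b < expectedLoss τ (p θ) - empiricalLoss D (p θ)} ≤ δ := by
  classical
  obtain ⟨S, hS, hSlim⟩ := hp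
  rcases isEmpty_or_nonempty Θ with hΘ | ⟨⟨θ₀⟩⟩
  · simp
  obtain ⟨u₀, hu₀, -⟩ := hSlim θ₀
  obtain ⟨s, rfl⟩ := hS.exists_eq_range ⟨_, hu₀ 0⟩
  set E : ℕ → Set (Fin n → Fin m → X × Y) := fun k =>
    {D | b < expectedLoss τ (p (s k)) - empiricalLoss D (p (s k))} with hE
  have hsub : {D | ∃ θ, b < expectedLoss τ (p θ) - empiricalLoss D (p θ)} ⊆ ⋃ k, E k := by
    rintro D ⟨θ, hθ⟩
    obtain ⟨u, huS, hu⟩ := hSlim θ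
    have hlim := (tendsto_expectedLoss (κ := fun k => p (u k)) hu τ).sub
      (tendsto_empiricalLoss (κ := fun k => p (u k)) hu D)
    obtain ⟨k, hk⟩ := (hlim.eventually (lt_mem_nhds hθ)).exists
    obtain ⟨i, hi⟩ := huS k
    refine Set.mem_iUnion.mpr ⟨i, ?_⟩
    simp only [hE, Set.mem_ofPred_eq, hi]
    exact hk
  refine (measure_mono hsub).trans ?_
  rw [measure_iUnion_eq_iSup_accumulate]
  refine iSup_le fun N => (measure_mono ?_).trans (h ((Finset.range (N + 1)).image s))
  intro D hD
  obtain ⟨k, hk, hkD⟩ := Set.mem_accumulate.mp hD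
  exact ⟨s k, Finset.mem_image_of_mem s (Finset.mem_range.mpr (Nat.lt_succ_of_le hk)), hkD⟩

end Encoder

/-! ### The generalization bound -/

section GeneralizationBound

set_option linter.unusedSectionVars false

variable {Θ X C Y : Type*} [MeasurableSpace X] [Fintype C] [MeasurableSpace C]
  [MeasurableSingletonClass C] [Fintype Y] [MeasurableSpace Y] [MeasurableSingletonClass Y]

/-- With a single code every encoder is constant, so its VC dimension is `0`. -/
lemma two_le_card_of_encoderVCDim {p : Θ → Kernel X C} [∀ θ, IsMarkovKernel (p θ)] {d : ℕ}
    (h : encoderVCDim p = d) (hd : 1 ≤ d) : 2 ≤ Fintype.card C := by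
  by_contra hC
  have hsub : Subsingleton C := Fintype.card_le_one_iff_subsingleton.mp (by omega)
  have h0 : encoderVCDim p ≤ 0 := by
    refine iSup₂_le fun S hS => ?_
    have hS' : S = ∅ := by
      by_contra hne
      obtain ⟨a, ha⟩ := Finset.nonempty_iff_ne_empty.mpr hne
      obtain ⟨_, ⟨θ, rfl⟩, h1⟩ := hS ∅ (Finset.empty_subset S)
      obtain ⟨_, ⟨θ', rfl⟩, h2⟩ := hS S subset_rfl
      have h1' := h1 a ha
      have h2' := h2 a ha
      have huniv : ({a.1.2} : Set C) = Set.univ := Set.eq_univ_of_forall fun c =>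
        Subsingleton.elim c a.1.2
      simp only [Set.mem_ofPred_eq, huniv, probReal_univ, ha, Finset.notMem_empty,
        iff_false, iff_true] at h1' h2'
      exact h1' h2'
    simp [hS']
  rw [h] at h0
  have : d ≤ 0 := by exact_mod_cast h0
  omega

lemma abs_mutualInfo_empiricalPMF_sub_le {m : ℕ} (hm : 1 ≤ m) (κ κ' : Kernel X C)
    [IsMarkovKernel κ] [IsMarkovKernel κ'] (D : Fin m → X × Y) {ε : ℝ} (hε : 0 < ε)
    (hlog : 1 ≤ -Real.log ε) :
    |mutualInfo (empiricalPMF κ D) - mutualInfo (empiricalPMF κ' D)| ≤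
      2 * (-Real.log ε * ((1 / (m : ℝ)) *
        ∑ j, ∑ c, |(κ (D j).1).real {c} - (κ' (D j).1).real {c}|) + Fintype.card C * ε) := by
  refine (abs_mutualInfo_sub_le (empiricalPMF_nonneg κ D) (empiricalPMF_nonneg κ' D)
    (sum_empiricalPMF hm κ D) (sum_empiricalPMF_codes κ κ' D) hε hlog).trans ?_
  gcongr
  exact sum_abs_empiricalPMF_sub_le κ κ' D

/-- A net of the encoders on all inputs of two samples is a net of the plug-in estimates. -/
lemma exists_net_mutualInfo {p : Θ → Kernel X C} [∀ θ, IsMarkovKernel (p θ)] {d : ℕ}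
    (h : encoderVCDim p = d) (hd : 1 ≤ d) {n m : ℕ} (hn : 1 ≤ n) (hm : 1 ≤ m) {ρ : ℝ} (hρ : 0 < ρ)
    (hlog : 1 ≤ -Real.log ρ) (F : Finset Θ)
    (w : Fin n → (Fin m → X × Y) × (Fin m → X × Y)) :
    ∃ V : Finset Θ, (V.card : ℝ) ≤ Real.exp (d * (2 * Real.log (2 / ρ) + 4)) ∧
      ∀ θ ∈ F, ∃ θ' ∈ V, ∑ k,
        |(mutualInfo (empiricalPMF (p θ) (w k).1) - mutualInfo (empiricalPMF (p θ) (w k).2)) -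
          (mutualInfo (empiricalPMF (p θ') (w k).1) - mutualInfo (empiricalPMF (p θ') (w k).2))| ≤
        n * (4 * Fintype.card C * ρ * (-Real.log ρ + 1)) := by
  have hC : 0 < Fintype.card C := by
    have := two_le_card_of_encoderVCDim h hd
    omega
  have hCne : Nonempty C := Fintype.card_pos_iff.mp hC
  have hnne : Nonempty (Fin n) := ⟨⟨0, hn⟩⟩
  have hmne : Nonempty (Fin m) := ⟨⟨0, hm⟩⟩
  have hm' : (0 : ℝ) < m := by positivity
  have hρ1 : ρ ≤ 1 := by
    by_contra hlt
    have := Real.log_nonneg (not_le.mp hlt).le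
    linarith
  obtain ⟨V, -, hVcard, hV⟩ := exists_net (P := Fin n × Bool × Fin m × C)
    (f := fun (θ : Θ) (e : X × C) => (p θ e.1).real {e.2})
    (fun θ e => ⟨measureReal_nonneg, measureReal_le_one⟩)
    (fun q => ((if q.2.1 then (w q.1).2 q.2.2.1 else (w q.1).1 q.2.2.1).1, q.2.2.2)) hd h.le hρ hρ1
    F
  refine ⟨V, (Real.le_exp_log _).trans (Real.exp_le_exp.mpr hVcard), fun θ hθ => ?_⟩
  obtain ⟨θ', hθ', hdist⟩ := hV θ hθ
  refine ⟨θ', hθ', ?_⟩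
  simp only [Fintype.sum_prod_type, Fintype.sum_bool, Fintype.card_prod, Fintype.card_fin,
    Fintype.card_bool, if_true, Bool.false_eq_true, if_false] at hdist
  set s : (Fin m → X × Y) → ℝ := fun D =>
    ∑ j, ∑ c, |(p θ (D j).1).real {c} - (p θ' (D j).1).real {c}| with hs
  have hterm : ∀ k,
      |(mutualInfo (empiricalPMF (p θ) (w k).1) - mutualInfo (empiricalPMF (p θ) (w k).2)) -
          (mutualInfo (empiricalPMF (p θ') (w k).1) - mutualInfo (empiricalPMF (p θ') (w k).2))| ≤
        2 * (-Real.log ρ) / m * (s (w k).2 + s (w k).1) + 4 * (Fintype.card C * ρ) := by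
    intro k
    have h1 := abs_mutualInfo_empiricalPMF_sub_le hm (p θ) (p θ') (w k).1 hρ hlog
    have h2 := abs_mutualInfo_empiricalPMF_sub_le hm (p θ) (p θ') (w k).2 hρ hlog
    have h3 : 2 * (-Real.log ρ) / m * (s (w k).2 + s (w k).1) + 4 * (Fintype.card C * ρ) =
        2 * (-Real.log ρ * ((1 / (m : ℝ)) * s (w k).1) + Fintype.card C * ρ) +
        2 * (-Real.log ρ * ((1 / (m : ℝ)) * s (w k).2) + Fintype.card C * ρ) := by ring
    rw [h3]
    refine le_trans ?_ (add_le_add h1 h2)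
    rw [sub_sub_sub_comm]
    exact abs_sub _ _
  refine (Finset.sum_le_sum fun k _ => hterm k).trans ?_
  rw [Finset.sum_add_distrib, ← Finset.mul_sum]
  have hbound : 2 * (-Real.log ρ) / m * ∑ k, (s (w k).2 + s (w k).1) ≤
      2 * (-Real.log ρ) / m * (ρ * ((n * (2 * (m * Fintype.card C)) : ℕ) : ℝ)) := by
    refine mul_le_mul_of_nonneg_left hdist (div_nonneg (by linarith) hm'.le)
  have heq : 2 * (-Real.log ρ) / m * (ρ * ((n * (2 * (m * Fintype.card C)) : ℕ) : ℝ)) =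
      n * (4 * Fintype.card C * ρ * -Real.log ρ) := by
    push_cast
    field_simp
    ring
  simp only [Finset.sum_const, Finset.card_univ, Fintype.card_fin, nsmul_eq_mul]
  rw [heq] at hbound
  linarith

/-- The choice of the exponential parameter `l = √(r b / a)`, where `a = log |C|`, `r = d / n` and
`b = log (n / d)`: every term of the exponent becomes a multiple of `d a b`. As `a, b ≥ log 2`, the
positive terms add up to less than `50 d a b`, and `3 d a b ≥ 1` pays for `log δ`. -/
lemma exponent_le {a b r d n δ : ℝ} (ha : Real.log 2 ≤ a) (hb : Real.log 2 ≤ b) (hr : 0 < r)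
    (hrb : r * b ≤ 1) (hd : 1 ≤ d) (hdn : n * r = d) (hn : 0 < n) (hδ0 : 0 < δ) (hδ1 : δ < 1) :
    d * (2 * (Real.log 2 + (a + b)) + 4) + (√(r * b) / √a * (n * (4 * r * (a + b + 1))) +
      n * ((√(r * b) / √a) ^ 2 * (2 * a) ^ 2 / 2) - √(r * b) / √a *
        (n * ((50 + 3 * -Real.log δ) * a ^ (3 / 2 : ℝ) * √(r * b)))) ≤ Real.log δ := by
  have hl2 := Real.log_two_gt_d9
  have hl2' := Real.log_two_lt_d9
  have ha' : 0.69 ≤ a := by linarith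
  have hb' : 0.69 ≤ b := by linarith
  have ha0 : 0 < a := by linarith
  have hb0 : 0 < b := by linarith
  have hsa : 0 < √a := Real.sqrt_pos.mpr ha0
  have hsa2 : √a * √a = a := Real.mul_self_sqrt ha0.le
  have hx0 : 0 ≤ √(r * b) := Real.sqrt_nonneg _
  have hx1 : √(r * b) ≤ 1 := Real.sqrt_le_one.mpr hrb
  have hx2 : √(r * b) * √(r * b) = r * b := Real.mul_self_sqrt (by positivity)
  set x := √(r * b) with hx
  have hpow : a ^ (3 / 2 : ℝ) = a * √a := by
    rw [show (3 / 2 : ℝ) = 1 + 1 / 2 by norm_num, Real.rpow_add ha0, Real.rpow_one,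
      Real.sqrt_eq_rpow]
  have hlδ : Real.log δ < 0 := Real.log_neg hδ0 hδ1
  have hxa : x / √a ≤ 1.25 := by
    rw [div_le_iff₀ hsa]
    have : 0.8 ≤ √a := Real.le_sqrt_of_sq_le (by norm_num; linarith)
    linarith
  have h1 : x / √a * (n * (4 * r * (a + b + 1))) ≤ 5 * d * (a + b + 1) := by
    have e : x / √a * (n * (4 * r * (a + b + 1))) = x / √a * (4 * d * (a + b + 1)) := by
      rw [← hdn]; ring
    rw [e]
    refine (mul_le_mul_of_nonneg_right hxa (by positivity)).trans (le_of_eq (by ring))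
  have h2 : n * ((x / √a) ^ 2 * (2 * a) ^ 2 / 2) = 2 * d * (a * b) := by
    have e : (x / √a) ^ 2 = r * b / a := by rw [div_pow, sq, sq, hx2, hsa2]
    rw [e, ← hdn]
    field_simp
  have h3 : x / √a * (n * ((50 + 3 * -Real.log δ) * a ^ (3 / 2 : ℝ) * x)) =
      (50 + 3 * -Real.log δ) * (d * (a * b)) := by
    rw [hpow]
    have e : x / √a * (n * ((50 + 3 * -Real.log δ) * (a * √a) * x)) =
      (50 + 3 * -Real.log δ) * n * a * (x * x) := by
      field_simp
    rw [e, hx2, ← hdn]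
    ring
  rw [h2, h3]
  have haab : 0.69 * a ≤ a * b := by
    rw [mul_comm]; exact mul_le_mul_of_nonneg_left hb' ha0.le
  have hbab : 0.69 * b ≤ a * b := mul_le_mul_of_nonneg_right ha' hb0.le
  have hab : 0.47 ≤ a * b := by linarith
  have hone : 1 ≤ 2.2 * (a * b) := by linarith
  have hD : -Real.log δ * 1 ≤ -Real.log δ * (3 * (d * (a * b))) := by
    refine mul_le_mul_of_nonneg_left ?_ (by linarith)
    have : a * b ≤ d * (a * b) := le_mul_of_one_le_left (by linarith) hd
    linarith
  have hpoly : 2 * (Real.log 2 + (a + b)) + 4 + 5 * (a + b + 1) + 2 * (a * b) ≤ 50 * (a * b) := by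
    linarith
  have hpoly' := mul_le_mul_of_nonneg_left hpoly (by linarith : (0 : ℝ) ≤ d)
  linarith

/-- The bound for a finite subclass, with explicit constants. -/
lemma dataLaw_finset_le {p : Θ → Kernel X C} [∀ θ, IsMarkovKernel (p θ)] {d : ℕ}
    (h : encoderVCDim p = d) (hd : 1 ≤ d) (τ : Measure (ProbabilityMeasure (X × Y)))
    [IsProbabilityMeasure τ] {n m : ℕ} (hn : 2 * d ≤ n) (hm : 1 ≤ m) {δ : ℝ} (hδ0 : 0 < δ)
    (hδ1 : δ < 1) (F : Finset Θ) :
    dataLaw τ n m {D | ∃ θ ∈ F,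
      (50 + 3 * -Real.log δ) * Real.log (Fintype.card C) ^ (3 / 2 : ℝ) *
          √((d : ℝ) / n * Real.log ((n : ℝ) / d)) + Fintype.card C * Fintype.card Y / m
        < expectedLoss τ (p θ) - empiricalLoss D (p θ)} ≤ ENNReal.ofReal δ := by
  have hC : (2 : ℝ) ≤ Fintype.card C := by exact_mod_cast two_le_card_of_encoderVCDim h hd
  have hd' : (1 : ℝ) ≤ d := by exact_mod_cast hd
  have hn' : 2 * (d : ℝ) ≤ n := by exact_mod_cast hn
  have hn0 : (0 : ℝ) < n := by linarith
  have hd0 : (0 : ℝ) < d := by linarith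
  obtain ⟨a, ha⟩ : ∃ a, a = Real.log (Fintype.card C) := ⟨_, rfl⟩
  obtain ⟨b, hb⟩ : ∃ b, b = Real.log ((n : ℝ) / d) := ⟨_, rfl⟩
  obtain ⟨r, hr⟩ : ∃ r, r = (d : ℝ) / n := ⟨_, rfl⟩
  have hr0 : 0 < r := by rw [hr]; positivity
  have ha2 : Real.log 2 ≤ a := ha ▸ Real.log_le_log (by norm_num) hC
  have hnd : 2 ≤ (n : ℝ) / d := by rwa [le_div_iff₀ hd0]
  have hb2 : Real.log 2 ≤ b := hb ▸ Real.log_le_log (by norm_num) hnd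
  have hrb : r * b ≤ 1 := by
    have h1 := Real.log_le_sub_one_of_pos (lt_of_lt_of_le two_pos hnd)
    have h2 : r * b ≤ r * ((n : ℝ) / d) := by
      rw [hb]
      exact mul_le_mul_of_nonneg_left (by linarith) hr0.le
    have h3 : r * ((n : ℝ) / d) = 1 := by rw [hr]; field_simp
    linarith
  -- The resolution of the net: `|C| ρ = d / n` makes the approximation error negligible.
  obtain ⟨ρ, hρ⟩ : ∃ ρ, ρ = r / Fintype.card C := ⟨_, rfl⟩
  have hρ0 : 0 < ρ := by rw [hρ]; positivity
  have hlogρ : -Real.log ρ = a + b := by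
    rw [hρ, Real.log_div hr0.ne' (by positivity), hr, ha, hb, ← inv_div, Real.log_inv]
    ring
  have hlog1 : 1 ≤ -Real.log ρ := by
    have := Real.log_two_gt_d9
    rw [hlogρ]; linarith
  have hlog2ρ : Real.log (2 / ρ) = Real.log 2 + (a + b) := by
    rw [Real.log_div two_ne_zero hρ0.ne', ← hlogρ]
    ring
  set μ := sampleKernel (X × Y) m ∘ₘ τ with hμ
  set g : Θ → (Fin m → X × Y) → ℝ := fun θ D => mutualInfo (empiricalPMF (p θ) D) with hg
  have hsub : {D : Fin n → Fin m → X × Y | ∃ θ ∈ F,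
      (50 + 3 * -Real.log δ) * Real.log (Fintype.card C) ^ (3 / 2 : ℝ) *
          √((d : ℝ) / n * Real.log ((n : ℝ) / d)) + Fintype.card C * Fintype.card Y / m
        < expectedLoss τ (p θ) - empiricalLoss D (p θ)} ⊆
      {D | ∃ θ ∈ F, n * ((50 + 3 * -Real.log δ) * a ^ (3 / 2 : ℝ) * √(r * b)) <
        ∑ k, (g θ (D k) - ∫ z, g θ z ∂μ)} := by
    rintro D ⟨θ, hθ, hlt⟩
    refine ⟨θ, hθ, ?_⟩
    rw [← ha, ← hb, ← hr] at hlt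
    have hbias := integral_mutualInfo_empiricalPMF_le (Y := Y) hm (p θ) τ
    have hemp : -empiricalLoss D (p θ) = (1 / (n : ℝ)) * ∑ k, g θ (D k) := by
      rw [empiricalLoss, neg_neg]
    rw [Finset.sum_sub_distrib, Finset.sum_const, Finset.card_univ, Fintype.card_fin, nsmul_eq_mul]
    have hlt' : (50 + 3 * -Real.log δ) * a ^ (3 / 2 : ℝ) * √(r * b) <
        (1 / (n : ℝ)) * ∑ k, g θ (D k) - ∫ z, g θ z ∂μ := by
      rw [← hemp]
      linarith
    refine (mul_lt_mul_of_pos_left hlt' hn0).trans_eq ?_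
    rw [mul_sub, ← mul_assoc (n : ℝ), mul_one_div_cancel hn0.ne', one_mul]
  refine (measure_mono hsub).trans ?_
  have hdev := measure_exists_deviation_le (μ := μ) (F := F) (g := g) (n := n)
    (l := √(r * b) / √a) (c := a) (by positivity)
    (fun θ => measurable_mutualInfo_empiricalPMF (p θ))
    (fun θ D => ha ▸ abs_mutualInfo_empiricalPMF_le hm (p θ) D)
    (exists_net_mutualInfo h hd (by omega) hm hρ0 hlog1 F)
    (n * ((50 + 3 * -Real.log δ) * a ^ (3 / 2 : ℝ) * √(r * b)))
  refine hdev.trans (ENNReal.ofReal_le_ofReal ?_)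
  have hCρ : 4 * Fintype.card C * ρ * (-Real.log ρ + 1) = 4 * r * (a + b + 1) := by
    rw [hlogρ, hρ]
    field_simp
  rw [hCρ, hlog2ρ, ← Real.exp_add, ← Real.le_log_iff_exp_le hδ0]
  exact exponent_le ha2 hb2 hr0 hrb hd' (by rw [hr]; field_simp) hn0 hδ0 hδ1

end GeneralizationBound

end DiscreteCodes

end

theorem theorem1 (δ : ℝ) (hδ0 : 0 < δ) (hδ1 : δ < 1) :
    ∃ K : ℝ, 0 < K ∧
      ∀ (Θ : Type*) (X : Type*) (C : Type*) (Y : Type*)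
        [MeasurableSpace X]
        [Fintype C] [MeasurableSpace C] [MeasurableSingletonClass C]
        [Fintype Y] [MeasurableSpace Y] [MeasurableSingletonClass Y]
        (p : Θ → Kernel X C) [∀ θ, IsMarkovKernel (p θ)]
        (_ : DiscreteCodes.PointwiseSeparable p)
        (d : ℕ) (_ : DiscreteCodes.encoderVCDim p = (d : ℕ∞)) (_ : 1 ≤ d)
        (τ : Measure (ProbabilityMeasure (X × Y))) [IsProbabilityMeasure τ]
        (n m : ℕ) (_ : 2 * d ≤ n) (_ : 1 ≤ m),
        DiscreteCodes.dataLaw τ n m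
          {D | ∃ θ : Θ,
            K * Real.log (Fintype.card C) ^ (3 / 2 : ℝ) *
                  √((d : ℝ) / n * Real.log ((n : ℝ) / d))
                + K * ((Fintype.card C : ℝ) * Real.log m / √(m : ℝ))
                + K * ((Fintype.card C : ℝ) * (Fintype.card Y : ℝ) / m)
              < DiscreteCodes.expectedLoss τ (p θ) - DiscreteCodes.empiricalLoss D (p θ)}
          ≤ ENNReal.ofReal δ := by
  have hlδ : Real.log δ < 0 := Real.log_neg hδ0 hδ1
  refine ⟨50 + 3 * -Real.log δ, by linarith, ?_⟩
  intro Θ X C Y _ _ _ _ _ _ _ p _ hsep d hvc hd τ _ n m hn hm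
  refine DiscreteCodes.measure_exists_le_of_finset hsep τ _ fun F => ?_
  refine (measure_mono ?_).trans (DiscreteCodes.dataLaw_finset_le hvc hd τ hn hm hδ0 hδ1 F)
  rintro D ⟨θ, hθ, hlt⟩
  refine ⟨θ, hθ, lt_of_le_of_lt ?_ hlt⟩
  -- The `log m` term is pure slack: the bias is already within the `|C| |Y| / m` term.
  have h1 : 0 ≤ (50 + 3 * -Real.log δ) * ((Fintype.card C : ℝ) * Real.log m / √(m : ℝ)) :=
    mul_nonneg (by linarith) (by positivity)
  have h2 : (Fintype.card C : ℝ) * Fintype.card Y / m ≤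
      (50 + 3 * -Real.log δ) * ((Fintype.card C : ℝ) * Fintype.card Y / m) :=
    le_mul_of_one_le_left (by positivity) (by linarith)
  linarith
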